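/- Let $N,d\ge 1$ be integers. Equip the space $\mathbb{M}_d^N$ of $N$-tuples $\mathbf{W}=(W_N,\dots,W_1)$ of real $d\times d$ matrices with the Frobenius norm $\|\mathbf W\|^2=\sum_{p=1}^N\mathrm{Tr}(W_p^TW_p)$, and let $\phi(\mathbf W)=W_NW_{N-1}\cdots W_1$. Let $\mathcal M\subset\mathbb M_d^N$ be the balanced manifold, the set of all $\mathbf W$ such that every $W_p$ has rank $d$ and $W_{p+1}^TW_{p+1}=W_pW_p^T$ for $1\le p\le N-1$. Let $c_d$ be the volume of the orthogonal group $O_d$ with respect to the Haar measure normalized as the $\frac{d(d-1)}2$-dimensional Riemannian volume of $O_d\subset\mathbb M_d$ for the Frobenius metric. **Theorem.** Let $X$ be a real $d\times d$ matrix of full rank with distinct singular values $\sigma_1>\sigma_2>\dots>\sigma_d$, and let $\Sigma=\mathrm{diag}(\sigma_1,\dots,\sigma_d)$. Put $n_*=(N-1)\frac{d(d-1)}2$, and let $\mathrm{vol}_{n_*}$ denote the $n_*$-dimensional volume for the metric induced from the Frobenius norm on $\mathbb M_d^N$. Then $0<c_d<\infty$ and $0<\mathrm{vol}_{n_*}\big(\phi^{-1}(X)\cap\mathcal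 M\big)<\infty$, and the Boltzmann entropy $$S(X)=\log\mathrm{vol}_{n_*}\big(\phi^{-1}(X)\cap\mathcal M\big)$$ satisfies $$S(X)=(N-1)\log c_d+\frac12\log\frac{\mathrm{van}(\Sigma^2)}{\mathrm{van}(\Sigma^{2/N})}=(N-1)\log c_d+\frac12\sum_{1\le i<j\le d}\log\left(\frac{\sigma_i^2-\sigma_j^2}{\sigma_i^{2/N}-\sigma_j^{2/N}}\right),$$ where, for a diagonal matrix $A=\mathrm{diag}(\alpha_1,\dots,\alpha_d)$, $\mathrm{van}(A)=\det\big(\alpha_i^{k-1}\big)_{1\le k,i\le d}=\prod_{1\le i<j\le d}(\alpha_j-\alpha_i)$. -/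

import Mathlib

open scoped MeasureTheory

namespace DLN

/-- The parameter space of `N`-tuples of real `d × d` matrices `(W_N, …, W_1)`, a Euclidean space
whose norm is the Frobenius norm `‖W‖² = ∑ₚ Tr (W_pᵀ W_p)` (see `normSq_eq_sum_trace`). -/
abbrev ParamSpace (N d : ℕ) : Type := EuclideanSpace ℝ (Fin N × Fin d × Fin d)

/-- The layer `W_{p+1}` of `W`, for `p = 0, …, N - 1`. -/
def layer {N d : ℕ} (W : ParamSpace N d) (p : Fin N) : Matrix (Fin d) (Fin d) ℝ :=
  Matrix.of fun i j => W (p, i, j)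

theorem normSq_eq_sum_trace {N d : ℕ} (W : ParamSpace N d) :
    ‖W‖ ^ 2 = ∑ p, ((layer W p).transpose * layer W p).trace := by
  rw [EuclideanSpace.real_norm_sq_eq, Fintype.sum_prod_type]
  refine Finset.sum_congr rfl fun p _ => ?_
  rw [Fintype.sum_prod_type, Finset.sum_comm]
  simp [layer, Matrix.trace, Matrix.mul_apply, pow_two]

/-- The end-to-end matrix `φ(W) = W_N W_{N-1} ⋯ W_1`. -/
def endToEnd {N d : ℕ} (W : ParamSpace N d) : Matrix (Fin d) (Fin d) ℝ :=
  (List.ofFn fun p : Fin N => layer W p.rev).prod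

/-- The fiber `φ⁻¹(X)`. -/
def fiber {d : ℕ} (N : ℕ) (X : Matrix (Fin d) (Fin d) ℝ) : Set (ParamSpace N d) :=
  {W | endToEnd W = X}

/-- The balanced manifold: `W_{p+1}ᵀ W_{p+1} = W_p W_pᵀ` for all pairs of consecutive layers, and
every layer has rank `d`. -/
def balancedManifold (N d : ℕ) : Set (ParamSpace N d) :=
  {W | (∀ p q : Fin N, (q : ℕ) = (p : ℕ) + 1 →
      (layer W q).transpose * layer W q = layer W p * (layer W p).transpose) ∧
    ∀ p, (layer W p).rank = d}

/-- The balanced fiber `φ⁻¹(X) ∩ 𝓜`. -/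
def balancedFiber {d : ℕ} (N : ℕ) (X : Matrix (Fin d) (Fin d) ℝ) : Set (ParamSpace N d) :=
  fiber N X ∩ balancedManifold N d

/-- `dim O_d = d (d - 1) / 2`. -/
def dimO (d : ℕ) : ℕ := d * (d - 1) / 2

/-- `n_* = (N - 1) d (d - 1) / 2`. -/
def nStar (N d : ℕ) : ℕ := (N - 1) * dimO d

/-- The `n_*`-dimensional volume of the balanced fiber for the metric induced from the ambient
Euclidean (Frobenius) space. `μHE[n]` is the `n`-dimensional Hausdorff measure, normalized to be
Lebesgue measure on `n`-dimensional Euclidean spaces, so that on `n`-dimensional embedded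
submanifolds it is the Riemannian volume of the induced metric. -/
noncomputable def fiberVolume {d : ℕ} (N : ℕ) (X : Matrix (Fin d) (Fin d) ℝ) : ENNReal :=
  μHE[nStar N d] (balancedFiber N X)

/-- The Boltzmann entropy `S(X)`. -/
noncomputable def entropy {d : ℕ} (N : ℕ) (X : Matrix (Fin d) (Fin d) ℝ) : ℝ :=
  Real.log (fiberVolume N X).toReal

/-- The orthogonal group `O_d`, as a subset of the `d × d` matrices with the Frobenius norm. -/
def orthogonalSet (d : ℕ) : Set (EuclideanSpace ℝ (Fin d × Fin d)) :=
  {Q | (Matrix.of fun i j => Q (i, j)) ∈ Matrix.orthogonalGroup (Fin d) ℝ}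

/-- The volume of `O_d` (for the bi-invariant metric induced by the Frobenius norm, whose volume
measure is a Haar measure). -/
noncomputable def volO (d : ℕ) : ENNReal := μHE[dimO d] (orthogonalSet d)

/-- The constant `c_d`, the volume of `O_d` as a real number. -/
noncomputable def cO (d : ℕ) : ℝ := (volO d).toReal

/-- The singular values of `X` in decreasing order. -/
noncomputable def sv {d : ℕ} (X : Matrix (Fin d) (Fin d) ℝ) (i : Fin d) : ℝ :=
  (Matrix.toEuclideanLin X).singularValues i

/-- The Vandermonde determinant of `diag(α_1, …, α_d)`, with rows `α_1 ^ k, …, α_d ^ k`. -/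
noncomputable def van {d : ℕ} (α : Fin d → ℝ) : ℝ :=
  (Matrix.of fun k i : Fin d => α i ^ (k : ℕ)).det

end DLN

namespace DLN

open MeasureTheory Measure Module Filter Topology
open scoped NNReal ENNReal Matrix

/-! ### Local area formula for Hausdorff measure -/

section Area

variable {α X Y : Type*} [MetricSpace X] [MeasurableSpace X] [BorelSpace X]
  [MetricSpace Y] [MeasurableSpace Y] [BorelSpace Y]

/-! Write `N = M + 1`, `X = U Σ Vᵀ` and `Λ = Σ^{1/N}`. Balancedness propagates `W_1ᵀ W_1` along the
layers and gives `Xᵀ X = (W_1ᵀ W_1)^N`. Uniqueness of positive semidefinite roots then determines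
`W_1ᵀ W_1`. Hence the balanced fiber consists exactly of the tuples `R_p Λ R_{p-1}ᵀ` with `R_0 = V`,
`R_N = U` and the `M` inner matrices free in `O_d` (`balancedFiber_eq`). Multiplication by
orthogonal matrices preserves the Frobenius norm, so one may take `U = V = 1`. The fiber is then an
injective image of `O_d^M` under `orbitMap`.

This parametrization intertwines left translation with isometries, so the pulled-back volume is left
invariant. By uniqueness of Haar measure it is a constant multiple of the `M`-fold product of the
volume of `O_d`. The constant is a ratio of Jacobians at the identity, found by comparing both
measures on shrinking boxes in a chart (`volume_orbit_pow`). No area formula is needed away from one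
point.

In the Cayley chart the differential on layer `q` is `A_{q+1} Λ - Λ A_q`, with `A_q` skew. Its Gram
matrix is block diagonal over pairs `i < j`, with each block twice the tridiagonal Toeplitz matrix
having diagonal `λ_i² + λ_j²` and off-diagonal `-λ_i λ_j` (`gram_orbitDeriv`). That determinant is
`(λ_i^{2N} - λ_j^{2N}) / (λ_i² - λ_j²)` (`det_tridiag_mul`). The factors of 2 cancel against the
Jacobian of `O_d` itself. Since `λ_i^N = σ_i`, the square root of the product over pairs gives the
Vandermonde ratio. -/

/-- If `f` is Lipschitz relative to `g` on `s`, then the volume of `f '' s` is controlled by the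
volume of `g '' s`. -/
theorem euclideanHausdorffMeasure_image_le_of_dist_le {f : α → X} {g : α → Y} {s : Set α}
    {K : ℝ≥0} (h : ∀ x ∈ s, ∀ y ∈ s, dist (f x) (f y) ≤ K * dist (g x) (g y)) (n : ℕ) :
    μHE[n] (f '' s) ≤ (K : ℝ≥0∞) ^ n * μHE[n] (g '' s) := by
  rcases s.eq_empty_or_nonempty with rfl | ⟨x₀, hx₀⟩
  · simp
  have : Nonempty α := ⟨x₀⟩
  have hmem : ∀ y ∈ g '' s, Function.invFunOn g s y ∈ s := fun y hy => Function.invFunOn_mem hy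
  have heq : ∀ y ∈ g '' s, g (Function.invFunOn g s y) = y := fun y hy => Function.invFunOn_eq hy
  have hlip : LipschitzOnWith K (f ∘ Function.invFunOn g s) (g '' s) := by
    refine LipschitzOnWith.of_dist_le_mul fun x hx y hy => ?_
    have := h _ (hmem x hx) _ (hmem y hy)
    rwa [heq x hx, heq y hy] at this
  -- The bound makes `f` constant on the fibers of `g` in `s`, so any choice of preimage yields the
  -- same value of `f`.
  have himg : f '' s ⊆ (f ∘ Function.invFunOn g s) '' (g '' s) := by
    rintro _ ⟨x, hx, rfl⟩
    refine ⟨g x, ⟨x, hx, rfl⟩, ?_⟩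
    have h1 := h _ (hmem (g x) ⟨x, hx, rfl⟩) _ hx
    rw [heq (g x) ⟨x, hx, rfl⟩, dist_self, mul_zero] at h1
    exact dist_le_zero.1 h1
  refine (measure_mono himg).trans ?_
  have := hlip.hausdorffMeasure_image_le (d := n) (Nat.cast_nonneg n)
  rw [ENNReal.rpow_natCast] at this
  simp only [euclideanHausdorffMeasure_def, Measure.smul_apply, nnreal_smul_coe_apply]
  rw [mul_left_comm]
  gcongr

variable {U V : Type*} [NormedAddCommGroup U] [InnerProductSpace ℝ U] [FiniteDimensional ℝ U]
  [MeasurableSpace U] [BorelSpace U]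
  [NormedAddCommGroup V] [InnerProductSpace ℝ V] [MeasurableSpace V] [BorelSpace V]

/-- Infinitesimal area formula for a map with injective strict derivative. -/
theorem exists_nhds_volume_image_comparable {f : U → V} {L : U →L[ℝ] V} {a : U}
    (hf : HasStrictFDerivAt f L a) (hL : Function.Injective L) {η : ℝ≥0} (hη : 1 < η) :
    ∃ t ∈ 𝓝 a, ∀ s ⊆ t,
      μHE[finrank ℝ U] (f '' s) ≤ η * (ENNReal.ofReal L.toLinearMap.normDet * volume s) ∧
      ENNReal.ofReal L.toLinearMap.normDet * volume s ≤ η * μHE[finrank ℝ U] (f '' s) := by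
  -- A distortion of distances by `δ` costs `δ ^ n` in `n`-dimensional volume.
  obtain ⟨δ, hδ1, hδ⟩ : ∃ δ : ℝ≥0, 1 < δ ∧ δ ^ finrank ℝ U ≤ η := by
    have hc : Tendsto (fun δ : ℝ≥0 => δ ^ finrank ℝ U) (𝓝 1) (𝓝 1) := by
      have : Continuous (fun δ : ℝ≥0 => δ ^ finrank ℝ U) := by fun_prop
      simpa using this.tendsto 1
    have h1 : ∀ᶠ δ : ℝ≥0 in 𝓝[>] 1, δ ^ finrank ℝ U < η :=
      (hc.eventually (gt_mem_nhds hη)).filter_mono nhdsWithin_le_nhds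
    obtain ⟨δ, h, h'⟩ := (h1.and self_mem_nhdsWithin).exists
    exact ⟨δ, h', h.le⟩
  obtain ⟨K, hK0, hK⟩ := L.toLinearMap.exists_antilipschitzWith (LinearMap.ker_eq_bot.2 hL)
  have hδr : (1 : ℝ) < δ := by exact_mod_cast hδ1
  have hKr : (0 : ℝ) < K := by exact_mod_cast hK0
  -- Chosen so that the linearization error is at most `(1 - δ⁻¹) ‖L x - L y‖`. Distances under `f`
  -- and `L` then differ by a factor of at most `δ` both ways, using `2 - δ⁻¹ ≤ δ` for the upper
  -- bound.
  set c : ℝ≥0 := ⟨(1 - (δ : ℝ)⁻¹) / K, div_nonneg (sub_nonneg.2 (inv_le_one_of_one_le₀ hδr.le))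
    hKr.le⟩ with hc
  have hcr : (c : ℝ) * K = 1 - (δ : ℝ)⁻¹ := by
    change (1 - (δ : ℝ)⁻¹) / K * K = _
    field_simp
  have hc0 : 0 < c := by
    rw [← NNReal.coe_pos]
    exact div_pos (sub_pos.2 (inv_lt_one_of_one_lt₀ hδr)) hKr
  obtain ⟨t, ht, hlin⟩ := hf.approximates_deriv_on_nhds (c := c) (Or.inr hc0)
  have hmain : ∀ x ∈ t, ∀ y ∈ t, ‖f x - f y - L (x - y)‖ ≤ (1 - (δ : ℝ)⁻¹) * ‖L x - L y‖ := by
    intro x hx y hy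
    refine (hlin x hx y hy).trans ?_
    rw [← hcr, mul_assoc]
    have := hK.le_mul_dist x y
    rw [dist_eq_norm, dist_eq_norm] at this
    gcongr
    exact this
  refine ⟨t, ht, fun s hs => ?_⟩
  have hA : μHE[finrank ℝ U] (f '' s) ≤ (δ : ℝ≥0∞) ^ finrank ℝ U * μHE[finrank ℝ U] (L '' s) := by
    refine euclideanHausdorffMeasure_image_le_of_dist_le (fun x hx y hy => ?_) _
    have h1 := hmain x (hs hx) y (hs hy)
    rw [dist_eq_norm, dist_eq_norm]
    have h2 : ‖f x - f y‖ ≤ ‖f x - f y - L (x - y)‖ + ‖L x - L y‖ := by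
      simpa [map_sub] using norm_add_le (f x - f y - L (x - y)) (L x - L y)
    have h3 : 2 - (δ : ℝ)⁻¹ ≤ δ := by
      have : (δ : ℝ) * (δ : ℝ)⁻¹ = 1 := by field_simp
      have : (0:ℝ) < (δ : ℝ)⁻¹ := by positivity
      nlinarith [sq_nonneg ((δ : ℝ) - 1)]
    nlinarith [norm_nonneg (L x - L y)]
  have hB : μHE[finrank ℝ U] (L '' s) ≤ (δ : ℝ≥0∞) ^ finrank ℝ U * μHE[finrank ℝ U] (f '' s) := by
    refine euclideanHausdorffMeasure_image_le_of_dist_le (fun x hx y hy => ?_) _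
    have h1 := hmain x (hs hx) y (hs hy)
    rw [dist_eq_norm, dist_eq_norm]
    have h2 : ‖L x - L y‖ ≤ ‖f x - f y - L (x - y)‖ + ‖f x - f y‖ := by
      have := norm_sub_le (f x - f y) (f x - f y - L (x - y))
      rw [sub_sub_cancel, map_sub] at this
      rw [map_sub]; linarith
    have h3 : (δ : ℝ)⁻¹ * ‖L x - L y‖ ≤ ‖f x - f y‖ := by linarith
    rwa [inv_mul_le_iff₀ (by positivity)] at h3
  have hvol := L.toLinearMap.euclideanHausdorffMeasure_image_eq_normDet_mul_volume s
  have hη' : (δ : ℝ≥0∞) ^ finrank ℝ U ≤ η := by exact_mod_cast hδ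
  rw [ContinuousLinearMap.coe_coe] at hvol
  rw [← hvol]
  exact ⟨hA.trans (by gcongr), hB.trans (by gcongr)⟩

end Area

/-! ### Coordinate cubes in Euclidean space -/

section Cube

variable (κ : Type*) [Fintype κ]

/-- The closed cube of half-side `r` around the origin. -/
def cube (r : ℝ) : Set (EuclideanSpace ℝ κ) := {x | ∀ k, |x k| ≤ r}

theorem cube_eq_preimage {r : ℝ} (hr : 0 ≤ r) :
    cube κ r = EuclideanSpace.equiv κ ℝ ⁻¹' Metric.closedBall 0 r := by
  ext x
  simp [cube, pi_norm_le_iff_of_nonneg hr]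

theorem isCompact_cube {r : ℝ} (hr : 0 ≤ r) : IsCompact (cube κ r) := by
  rw [cube_eq_preimage κ hr]
  exact (EuclideanSpace.equiv κ ℝ).toHomeomorph.isCompact_preimage.2 (isCompact_closedBall _ _)

theorem cube_mem_nhds {r : ℝ} (hr : 0 < r) : cube κ r ∈ 𝓝 (0 : EuclideanSpace ℝ κ) := by
  rw [cube_eq_preimage κ hr.le]
  exact (EuclideanSpace.equiv κ ℝ).continuous.continuousAt.preimage_mem_nhds
    (by simpa using Metric.closedBall_mem_nhds _ hr)

theorem volume_cube {r : ℝ} (hr : 0 ≤ r) :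
    volume (cube κ r) = ENNReal.ofReal (2 * r) ^ Fintype.card κ := by
  rw [cube_eq_preimage κ hr, ← ENNReal.ofReal_pow (by positivity),
    ← Real.volume_pi_closedBall (0 : κ → ℝ) hr]
  exact (PiLp.volume_preserving_ofLp κ).measure_preimage
    measurableSet_closedBall.nullMeasurableSet

theorem exists_cube_subset {t : Set (EuclideanSpace ℝ κ)} (ht : t ∈ 𝓝 0) :
    ∃ r > 0, ∀ r' ≤ r, 0 ≤ r' → cube κ r' ⊆ t := by
  have h : (EuclideanSpace.equiv κ ℝ).symm ⁻¹' t ∈ 𝓝 (0 : κ → ℝ) :=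
    (EuclideanSpace.equiv κ ℝ).symm.continuous.continuousAt.preimage_mem_nhds (by simpa using ht)
  obtain ⟨r, hr, h⟩ := Metric.nhds_basis_closedBall.mem_iff.1 h
  refine ⟨r, hr, fun r' hr' h0 => ?_⟩
  rw [cube_eq_preimage κ h0]
  intro x hx
  simpa using h (Metric.closedBall_subset_closedBall hr' hx)

end Cube

/-! ### Left-invariant measures from isometric actions -/

section HaarComparison

/-- Turns comparisons up to a factor arbitrarily close to 1 into exact inequalities, by letting `η`
decrease to 1. -/
theorem le_of_forall_one_lt_le_pow_mul {x y : ℝ≥0∞} (k : ℕ)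
    (h : ∀ η : ℝ≥0, 1 < η → x ≤ (η : ℝ≥0∞) ^ k * y) : x ≤ y := by
  have hc : Continuous (fun η : ℝ≥0 => ((η ^ k : ℝ≥0) : ℝ≥0∞)) :=
    ENNReal.continuous_coe.comp (by fun_prop)
  have ht : Tendsto (fun η : ℝ≥0 => ((η ^ k : ℝ≥0) : ℝ≥0∞) * y) (𝓝[>] 1) (𝓝 (1 * y)) := by
    refine ENNReal.Tendsto.mul_const ?_ (Or.inl one_ne_zero)
    simpa using (hc.tendsto 1).mono_left nhdsWithin_le_nhds
  rw [one_mul] at ht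
  refine ge_of_tendsto ht ?_
  filter_upwards [self_mem_nhdsWithin] with η hη
  simpa using h η hη

theorem comap_volume_apply {H E : Type*} [TopologicalSpace H] [CompactSpace H]
    [MeasurableSpace H] [BorelSpace H] [MetricSpace E] [MeasurableSpace E] [BorelSpace E]
    {Φ : H → E} (hc : Continuous Φ) (hi : Function.Injective Φ) (n : ℕ) (s : Set H) :
    (μHE[n].comap Φ) s = μHE[n] (Φ '' s) :=
  (hc.isClosedEmbedding hi).measurableEmbedding.comap_apply _ _

variable {H E : Type*} [Group H] [TopologicalSpace H] [IsTopologicalGroup H] [CompactSpace H]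
  [MeasurableSpace H] [BorelSpace H] [MetricSpace E] [MeasurableSpace E] [BorelSpace E]

/-- The volume of a compact group orbit under isometries is left invariant. -/
theorem isMulLeftInvariant_comap_volume {Φ : H → E} (hc : Continuous Φ) (hi : Function.Injective Φ)
    (hΦ : ∀ g, ∃ T : E → E, Isometry T ∧ ∀ h, Φ (g * h) = T (Φ h)) (n : ℕ) :
    (μHE[n].comap Φ).IsMulLeftInvariant := by
  refine ⟨fun g => ?_⟩
  ext s hs
  obtain ⟨T, hT, hTΦ⟩ := hΦ g
  have hs' : MeasurableSet ((g * ·) ⁻¹' s) := (measurable_const_mul g) hs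
  rw [map_apply (measurable_const_mul g) hs, comap_volume_apply hc hi n _,
    comap_volume_apply hc hi n s, ← hT.euclideanHausdorffMeasure_image, Set.image_image]
  congr 1
  ext y
  constructor
  · rintro ⟨h, hh, rfl⟩
    exact ⟨g * h, hh, hTΦ h⟩
  · rintro ⟨h, hh, rfl⟩
    exact ⟨g⁻¹ * h, by simpa using hh, by simp [← hTΦ]⟩

theorem normDet_pos_of_injective {U V : Type*} [NormedAddCommGroup U] [InnerProductSpace ℝ U]
    [FiniteDimensional ℝ U] [NormedAddCommGroup V] [InnerProductSpace ℝ V] {L : U →L[ℝ] V}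
    (hL : Function.Injective L) : 0 < L.toLinearMap.normDet :=
  L.toLinearMap.normDet_nonneg.lt_of_ne' fun h =>
    LinearMap.normDet_eq_zero_iff_ker_ne_bot.1 h (LinearMap.ker_eq_bot.2 hL)

end HaarComparison

/-- The product of copies of a chart. -/
def piChart {G κ : Type*} (M : ℕ) (c : EuclideanSpace ℝ κ → G) (x : EuclideanSpace ℝ (Fin M × κ)) : Fin M → G :=
  fun p => c (WithLp.toLp 2 fun k => x (p, k))

/-- The reason for working with cubes rather than Euclidean balls: a cube in the product chart is a
product of cubes, so product measures can be evaluated on its image. -/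
theorem piChart_image_cube {G κ : Type*} [Fintype κ] (M : ℕ) (c : EuclideanSpace ℝ κ → G) (r : ℝ) :
    piChart M c '' cube (Fin M × κ) r = Set.univ.pi fun _ => c '' cube κ r := by
  ext g
  simp only [Set.mem_image, Set.mem_univ_pi]
  constructor
  · rintro ⟨x, hx, rfl⟩ p
    exact ⟨_, fun k => hx (p, k), rfl⟩
  · intro h
    choose y hy hyg using h
    refine ⟨WithLp.toLp 2 fun q => y q.1 q.2, fun q => hy q.1 q.2, ?_⟩
    ext p
    exact hyg p

/-! ### Volume of an orbit of a power of a compact group -/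

section Orbit

variable {G : Type*} [Group G] [TopologicalSpace G] [IsTopologicalGroup G] [CompactSpace G]
  [SecondCountableTopology G] [MeasurableSpace G] [BorelSpace G]
  {E F : Type*} [NormedAddCommGroup E] [InnerProductSpace ℝ E] [MeasurableSpace E] [BorelSpace E]
  [NormedAddCommGroup F] [InnerProductSpace ℝ F] [MeasurableSpace F] [BorelSpace F]
  {κ : Type*} [Fintype κ]

theorem exists_cube_volume_comparable {H : Type*} {Φ : H → E} {c : EuclideanSpace ℝ κ → H}
    {L : EuclideanSpace ℝ κ →L[ℝ] E} (hL : HasStrictFDerivAt (Φ ∘ c) L 0)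
    (hLi : Function.Injective L) {η : ℝ≥0} (hη : 1 < η) :
    ∃ r > 0, ∀ r' ≤ r, 0 ≤ r' →
      μHE[Fintype.card κ] (Φ '' (c '' cube κ r')) ≤
        η * (ENNReal.ofReal L.toLinearMap.normDet * ENNReal.ofReal (2 * r') ^ Fintype.card κ) ∧
      ENNReal.ofReal L.toLinearMap.normDet * ENNReal.ofReal (2 * r') ^ Fintype.card κ ≤
        η * μHE[Fintype.card κ] (Φ '' (c '' cube κ r')) := by
  obtain ⟨t, ht, h⟩ := exists_nhds_volume_image_comparable hL hLi hη
  obtain ⟨r, hr, hrt⟩ := exists_cube_subset κ ht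
  refine ⟨r, hr, fun r' hr' h0 => ?_⟩
  have := h _ (hrt r' hr' h0)
  rwa [volume_cube κ h0, Set.image_comp, finrank_euclideanSpace] at this

/-- The volume of an orbit of a power of a compact group acting by isometries, compared with the
volume of an orbit of the group itself. -/
theorem volume_orbit_pow {M : ℕ} {i : G → E} {Φ : (Fin M → G) → F}
    (hic : Continuous i) (hii : Function.Injective i)
    (hie : ∀ g, ∃ T : E → E, Isometry T ∧ ∀ h, i (g * h) = T (i h))
    (hΦc : Continuous Φ) (hΦi : Function.Injective Φ)
    (hΦe : ∀ g, ∃ T : F → F, Isometry T ∧ ∀ h, Φ (g * h) = T (Φ h))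
    {c : EuclideanSpace ℝ κ → G} (hc : Continuous c)
    (hc0 : ∀ r > 0, c '' cube κ r ∈ 𝓝 1)
    {L : EuclideanSpace ℝ κ →L[ℝ] E} (hL : HasStrictFDerivAt (i ∘ c) L 0)
    (hLi : Function.Injective L)
    {L' : EuclideanSpace ℝ (Fin M × κ) →L[ℝ] F} (hL' : HasStrictFDerivAt (Φ ∘ piChart M c) L' 0)
    (hLi' : Function.Injective L') :
    0 < μHE[Fintype.card κ] (Set.range i) ∧ μHE[Fintype.card κ] (Set.range i) < ⊤ ∧
    μHE[M * Fintype.card κ] (Set.range Φ) * ENNReal.ofReal L.toLinearMap.normDet ^ M =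
      ENNReal.ofReal L'.toLinearMap.normDet * μHE[Fintype.card κ] (Set.range i) ^ M := by
  set n := Fintype.card κ with hn
  have hcard : Fintype.card (Fin M × κ) = M * n := by simp [hn]
  set J := ENNReal.ofReal L.toLinearMap.normDet with hJ
  set J' := ENNReal.ofReal L'.toLinearMap.normDet with hJ'
  have hJ0 : J ≠ 0 := by simpa [hJ] using normDet_pos_of_injective hLi
  have hJt : J ≠ ⊤ := ENNReal.ofReal_ne_top
  have hJt' : J' ≠ ⊤ := ENNReal.ofReal_ne_top
  have : T2Space G := T2Space.of_injective_continuous hii hic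
  let μ : Measure G := μHE[n].comap i
  let ν : Measure (Fin M → G) := μHE[M * n].comap Φ
  have hμ : μ.IsMulLeftInvariant := isMulLeftInvariant_comap_volume hic hii hie n
  have hν : ν.IsMulLeftInvariant := isMulLeftInvariant_comap_volume hΦc hΦi hΦe _
  have hcomp : ∀ r : ℝ, 0 ≤ r → IsCompact (c '' cube κ r) := fun r hr =>
    (isCompact_cube κ hr).image hc
  have hpt : ∀ r : ℝ, 0 ≤ r → μ (c '' cube κ r) = μHE[n] (i '' (c '' cube κ r)) := fun r hr =>
    comap_volume_apply hic hii n _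
  have hpt' : ∀ r : ℝ, 0 ≤ r → ν (Set.univ.pi fun _ => c '' cube κ r) =
      μHE[M * n] (Φ '' (piChart M c '' cube (Fin M × κ) r)) := fun r hr => by
    rw [piChart_image_cube]
    exact comap_volume_apply hΦc hΦi _ _
  -- One radius serves both charts, so the two measures are compared on the same small box around
  -- the identity.
  have hcmp : ∀ η : ℝ≥0, 1 < η → ∃ r > 0,
      μ (c '' cube κ r) ≤ η * (J * ENNReal.ofReal (2 * r) ^ n) ∧
      J * ENNReal.ofReal (2 * r) ^ n ≤ η * μ (c '' cube κ r) ∧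
      ν (Set.univ.pi fun _ => c '' cube κ r) ≤ η * (J' * (ENNReal.ofReal (2 * r) ^ n) ^ M) ∧
      J' * (ENNReal.ofReal (2 * r) ^ n) ^ M ≤ η * ν (Set.univ.pi fun _ => c '' cube κ r) := by
    intro η hη
    obtain ⟨r₁, hr₁, h₁⟩ := exists_cube_volume_comparable hL hLi hη
    obtain ⟨r₂, hr₂, h₂⟩ := exists_cube_volume_comparable hL' hLi' hη
    have hr : 0 < min r₁ r₂ := lt_min hr₁ hr₂
    refine ⟨min r₁ r₂, hr, ?_⟩
    have e₁ := h₁ _ (min_le_left _ _) hr.le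
    have e₂ := h₂ _ (min_le_right _ _) hr.le
    rw [hcard] at e₂
    rw [hpt _ hr.le, hpt' _ hr.le, ← pow_mul, mul_comm n M]
    exact ⟨e₁.1, e₁.2, e₂.1, e₂.2⟩
  have hfin : IsHaarMeasure μ ∧ IsFiniteMeasureOnCompacts ν := by
    -- Any single `η` suffices: one compact neighbourhood of finite measure, nonzero for `μ`, is
    -- enough by invariance.
    obtain ⟨r, hr, h₁, h₂, h₃, h₄⟩ := hcmp 2 (by norm_num)
    have hv0 : ENNReal.ofReal (2 * r) ^ n ≠ 0 := by simp [hr]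
    have hvt : ENNReal.ofReal (2 * r) ^ n ≠ ⊤ := ENNReal.pow_ne_top ENNReal.ofReal_ne_top
    have hint : (interior (c '' cube κ r)).Nonempty := ⟨1, mem_interior_iff_mem_nhds.2 (hc0 r hr)⟩
    constructor
    · refine isHaarMeasure_of_isCompact_nonempty_interior μ _ (hcomp r hr.le) hint ?_ ?_
      · intro h0
        rw [h0, mul_zero, nonpos_iff_eq_zero, mul_eq_zero] at h₂
        exact h₂.elim hJ0 hv0
      · exact ne_top_of_le_ne_top (by finiteness) h₁
    · refine ⟨fun K hK => measure_lt_top_of_isCompact_of_isMulLeftInvariant'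
        (U := Set.univ.pi fun _ => c '' cube κ r) ⟨1, mem_interior_iff_mem_nhds.2 ?_⟩ ?_ hK⟩
      · exact set_pi_mem_nhds Set.finite_univ fun _ _ => hc0 r hr
      · exact ne_top_of_le_ne_top (by finiteness) h₃
  obtain ⟨hμH, hνF⟩ := hfin
  have hprod := isMulInvariant_eq_smul_of_compactSpace ν (Measure.pi fun _ : Fin M => μ)
  set a := haarScalarFactor ν (Measure.pi fun _ : Fin M => μ)
  have hbox : ∀ s : Set G, ν (Set.univ.pi fun _ => s) = a * μ s ^ M := by
    intro s
    rw [hprod, Measure.smul_apply, nnreal_smul_coe_apply, Measure.pi_pi]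
    simp
  -- Evaluating both measures on a small box costs one factor `η` for `ν` and `M` of them for `μ ^
  -- M`, whence the exponent `M + 1`. The box volume cancels.
  have hconst : a * J ^ M = J' := by
    apply le_antisymm
    · refine le_of_forall_one_lt_le_pow_mul (M + 1) fun η hη => ?_
      obtain ⟨r, hr, h₁, h₂, h₃, h₄⟩ := hcmp η hη
      have hv0 : (ENNReal.ofReal (2 * r) ^ n) ^ M ≠ 0 := by simp [hr]
      have hvt : (ENNReal.ofReal (2 * r) ^ n) ^ M ≠ ⊤ := by finiteness
      rw [hbox] at h₃
      rw [← ENNReal.mul_le_mul_iff_left hv0 hvt]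
      calc a * J ^ M * (ENNReal.ofReal (2 * r) ^ n) ^ M
          = a * (J * ENNReal.ofReal (2 * r) ^ n) ^ M := by ring
        _ ≤ a * (η * μ (c '' cube κ r)) ^ M := by gcongr
        _ = η ^ M * (a * μ (c '' cube κ r) ^ M) := by ring
        _ ≤ η ^ M * (η * (J' * (ENNReal.ofReal (2 * r) ^ n) ^ M)) := by gcongr
        _ = _ := by ring
    · refine le_of_forall_one_lt_le_pow_mul (M + 1) fun η hη => ?_
      obtain ⟨r, hr, h₁, h₂, h₃, h₄⟩ := hcmp η hη
      have hv0 : (ENNReal.ofReal (2 * r) ^ n) ^ M ≠ 0 := by simp [hr]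
      have hvt : (ENNReal.ofReal (2 * r) ^ n) ^ M ≠ ⊤ := by finiteness
      rw [hbox] at h₄
      rw [← ENNReal.mul_le_mul_iff_left hv0 hvt]
      calc J' * (ENNReal.ofReal (2 * r) ^ n) ^ M ≤ η * (a * μ (c '' cube κ r) ^ M) := h₄
        _ ≤ η * (a * (η * (J * ENNReal.ofReal (2 * r) ^ n)) ^ M) := by gcongr
        _ = _ := by ring
  have hi : μHE[n] (Set.range i) = μ Set.univ := by
    rw [← Set.image_univ]
    exact (comap_volume_apply hic hii n _).symm
  have hΦ : μHE[M * n] (Set.range Φ) = ν Set.univ := by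
    rw [← Set.image_univ]
    exact (comap_volume_apply hΦc hΦi _ _).symm
  rw [hi, hΦ, ← Set.pi_univ Set.univ, hbox, ← hconst]
  exact ⟨IsOpen.measure_pos μ isOpen_univ ⟨1, trivial⟩, isCompact_univ.measure_lt_top, by ring⟩

end Orbit

/-! ### The Cayley transform -/

section Cayley

variable {n : Type*} [Fintype n] [DecidableEq n]

/-- The Cayley transform. -/
noncomputable def cayley (B : Matrix n n ℝ) : Matrix n n ℝ := (1 + B) * (1 - B)⁻¹

/-- A skew form vanishes on the diagonal: if `B v = v` then `v ⬝ v = v ⬝ B v = 0`. -/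
theorem isUnit_det_one_sub_of_skew {B : Matrix n n ℝ} (hB : Bᵀ = -B) : IsUnit (1 - B).det := by
  rw [isUnit_iff_ne_zero]
  intro h
  obtain ⟨v, hv, hBv⟩ := Matrix.exists_mulVec_eq_zero_iff.2 h
  rw [Matrix.sub_mulVec, Matrix.one_mulVec, sub_eq_zero] at hBv
  have h1 : v ⬝ᵥ v = v ⬝ᵥ (B *ᵥ v) := by rw [← hBv]
  have h2 : v ⬝ᵥ (B *ᵥ v) = -(v ⬝ᵥ (B *ᵥ v)) := by
    conv_lhs => rw [Matrix.dotProduct_mulVec, ← Matrix.mulVec_transpose, hB, Matrix.neg_mulVec,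
      neg_dotProduct, dotProduct_comm]
  exact hv (dotProduct_self_eq_zero.1 (by linarith))

theorem cayley_mem_orthogonalGroup {B : Matrix n n ℝ} (hB : Bᵀ = -B) :
    cayley B ∈ Matrix.orthogonalGroup n ℝ := by
  have h1 := isUnit_det_one_sub_of_skew hB
  have h2 : IsUnit (1 + B).det := by
    have := isUnit_det_one_sub_of_skew (B := -B) (by simp [hB])
    rwa [sub_neg_eq_add] at this
  rw [Matrix.mem_orthogonalGroup_iff', cayley, Matrix.transpose_mul, Matrix.transpose_nonsing_inv,
    Matrix.transpose_add, Matrix.transpose_sub, hB, Matrix.transpose_one, sub_neg_eq_add,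
    ← sub_eq_add_neg]
  have hc : (1 - B) * (1 + B) = (1 + B) * (1 - B) := by noncomm_ring
  calc (1 + B)⁻¹ * (1 - B) * ((1 + B) * (1 - B)⁻¹)
      = (1 + B)⁻¹ * ((1 - B) * (1 + B)) * (1 - B)⁻¹ := by simp only [mul_assoc]
    _ = ((1 + B)⁻¹ * (1 + B)) * ((1 - B) * (1 - B)⁻¹) := by rw [hc]; simp only [mul_assoc]
    _ = 1 := by rw [Matrix.nonsing_inv_mul _ h2, Matrix.mul_nonsing_inv _ h1, one_mul]

/-- The inverse Cayley transform. -/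
noncomputable def cayleyInv (Q : Matrix n n ℝ) : Matrix n n ℝ := (Q - 1) * (1 + Q)⁻¹

theorem transpose_cayleyInv {Q : Matrix n n ℝ} (hQ : Q ∈ Matrix.orthogonalGroup n ℝ)
    (h : IsUnit (1 + Q).det) : (cayleyInv Q)ᵀ = -cayleyInv Q := by
  have hQ1 : Qᵀ * Q = 1 := (Matrix.mem_orthogonalGroup_iff' _ _).1 hQ
  have h' : IsUnit (1 + Qᵀ).det := by
    rwa [← Matrix.transpose_one, ← Matrix.transpose_add, Matrix.det_transpose]
  rw [cayleyInv, Matrix.transpose_mul, Matrix.transpose_nonsing_inv, Matrix.transpose_add,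
    Matrix.transpose_sub, Matrix.transpose_one]
  have key : (Qᵀ - 1) * (1 + Q) = (1 + Qᵀ) * (1 - Q) := by
    have : (Qᵀ - 1) * (1 + Q) - (1 + Qᵀ) * (1 - Q) = 2 • (Qᵀ * Q - 1) := by noncomm_ring
    rw [hQ1, sub_self, smul_zero, sub_eq_zero] at this
    exact this
  calc (1 + Qᵀ)⁻¹ * (Qᵀ - 1) = (1 + Qᵀ)⁻¹ * ((Qᵀ - 1) * (1 + Q)) * (1 + Q)⁻¹ := by
        rw [mul_assoc, mul_assoc (Qᵀ - 1), Matrix.mul_nonsing_inv _ h, mul_one]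
    _ = ((1 + Qᵀ)⁻¹ * (1 + Qᵀ)) * ((1 - Q) * (1 + Q)⁻¹) := by rw [key]; simp only [mul_assoc]
    _ = _ := by rw [Matrix.nonsing_inv_mul _ h', one_mul, ← neg_mul, neg_sub]

theorem cayley_cayleyInv {Q : Matrix n n ℝ} (h : IsUnit (1 + Q).det) :
    cayley (cayleyInv Q) = Q := by
  have h1 : 1 + cayleyInv Q = (2 : ℝ) • Q * (1 + Q)⁻¹ := by
    calc 1 + cayleyInv Q = (1 + Q) * (1 + Q)⁻¹ + (Q - 1) * (1 + Q)⁻¹ := by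
          rw [Matrix.mul_nonsing_inv _ h, cayleyInv]
      _ = _ := by rw [← add_mul, two_smul]; congr 1; abel
  have h2 : 1 - cayleyInv Q = (2 : ℝ) • (1 + Q)⁻¹ := by
    calc 1 - cayleyInv Q = (1 + Q) * (1 + Q)⁻¹ - (Q - 1) * (1 + Q)⁻¹ := by
          rw [Matrix.mul_nonsing_inv _ h, cayleyInv]
      _ = _ := by
        rw [← sub_mul, show 1 + Q - (Q - 1) = (2 : ℝ) • 1 by rw [two_smul]; abel, smul_mul_assoc,
          one_mul]
  have h3 : ((2 : ℝ) • (1 + Q)⁻¹)⁻¹ = (1 / 2 : ℝ) • (1 + Q) := by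
    apply Matrix.inv_eq_right_inv
    rw [smul_mul_smul_comm, Matrix.nonsing_inv_mul _ h]
    norm_num
  rw [cayley, h1, h2, h3, smul_mul_assoc, smul_mul_smul_comm, mul_assoc,
    Matrix.nonsing_inv_mul _ h]
  norm_num

/-- To first order `(1 + B)(1 - B)⁻¹ = 1 + 2 B`. Working entrywise keeps the statement free of any
choice of matrix norm; the Frobenius norm serves only to differentiate the ring inverse. -/
theorem hasStrictFDerivAt_cayley_apply {U : Type*} [NormedAddCommGroup U] [NormedSpace ℝ U]
    [FiniteDimensional ℝ U] (S : U →ₗ[ℝ] Matrix n n ℝ) (a b : n) {D : U →L[ℝ] ℝ}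
    (hD : ∀ x, D x = 2 * S x a b) :
    HasStrictFDerivAt (fun x => cayley (S x) a b) D 0 := by
  let : NormedRing (Matrix n n ℝ) := Matrix.frobeniusNormedRing
  let : NormedAlgebra ℝ (Matrix n n ℝ) := Matrix.frobeniusNormedAlgebra
  have : CompleteSpace (Matrix n n ℝ) := FiniteDimensional.complete ℝ _
  let Sc : U →L[ℝ] Matrix n n ℝ := S.toContinuousLinearMap
  let e : Matrix n n ℝ →L[ℝ] ℝ := (Matrix.entryLinearMap ℝ ℝ a b).toContinuousLinearMap
  have hS : HasStrictFDerivAt (fun x => S x) Sc 0 := Sc.hasStrictFDerivAt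
  have h1 : HasStrictFDerivAt (fun x => 1 - S x) (-Sc) 0 := hS.const_sub 1
  have h2 : HasStrictFDerivAt (fun x => 1 + S x) Sc 0 := hS.const_add 1
  have h3 : HasStrictFDerivAt (fun x => Ring.inverse (1 - S x))
      ((-((ContinuousLinearMap.mulLeftRight ℝ (Matrix n n ℝ)) 1) 1).comp (-Sc)) 0 := by
    have := hasStrictFDerivAt_ringInverse (𝕜 := ℝ) (1 : (Matrix n n ℝ)ˣ)
    simp only [inv_one, Units.val_one] at this
    exact HasStrictFDerivAt.comp (0 : U) (by simpa using this) h1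
  have h4 := e.hasStrictFDerivAt.comp (0 : U) (h2.mul' h3)
  refine (h4.congr_fderiv ?_).congr_of_eventuallyEq ?_
  · ext x
    change ((1 + S 0) * (-(1 * (-(S x)) * 1)) + S x * Ring.inverse (1 - S 0) : Matrix n n ℝ) a b = D x
    simp [hD, two_mul]
  · refine Eventually.of_forall fun x => ?_
    simp [e, cayley, Matrix.nonsing_inv_eq_ringInverse]

end Cayley

/-! ### The orthogonal group as a compact group isometrically acting on matrices -/

section OrthogonalGroup

/-- The orthogonal group as a topological group. -/
abbrev Orth (d : ℕ) : Type := Matrix.orthogonalGroup (Fin d) ℝ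

variable {d : ℕ}

theorem Orth.transpose_mul_self (Q : Orth d) : (Q.1)ᵀ * Q.1 = 1 :=
  (Matrix.mem_orthogonalGroup_iff' _ _).1 Q.2

theorem Orth.mul_transpose_self (Q : Orth d) : Q.1 * (Q.1)ᵀ = 1 :=
  (Matrix.mem_orthogonalGroup_iff _ _).1 Q.2

instance : SecondCountableTopology (Orth d) :=
  have : SecondCountableTopology (Matrix (Fin d) (Fin d) ℝ) :=
    inferInstanceAs (SecondCountableTopology (Fin d → Fin d → ℝ))
  Topology.IsInducing.subtypeVal.secondCountableTopology

instance : CompactSpace (Orth d) := by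
  refine isCompact_iff_compactSpace.1 ?_
  have hK : IsCompact (Set.univ.pi fun _ : Fin d => Set.univ.pi fun _ : Fin d =>
      Set.Icc (-1 : ℝ) 1) := isCompact_univ_pi fun _ => isCompact_univ_pi fun _ => isCompact_Icc
  refine IsCompact.of_isClosed_subset (X := Matrix (Fin d) (Fin d) ℝ) hK (isClosed_unitary) ?_
  intro Q hQ
  exact fun i _ j _ => abs_le.1 (entry_norm_bound_of_unitary hQ i j)

instance : MeasurableSpace (Orth d) := borel _

instance : BorelSpace (Orth d) := ⟨rfl⟩

/-- A matrix as a vector of the Euclidean space of its entries. -/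
def matVec (A : Matrix (Fin d) (Fin d) ℝ) : EuclideanSpace ℝ (Fin d × Fin d) :=
  WithLp.toLp 2 fun k => A k.1 k.2

@[simp] theorem matVec_apply (A : Matrix (Fin d) (Fin d) ℝ) (k : Fin d × Fin d) :
    matVec A k = A k.1 k.2 := rfl

theorem norm_matVec_sq (A : Matrix (Fin d) (Fin d) ℝ) : ‖matVec A‖ ^ 2 = (Aᵀ * A).trace := by
  rw [EuclideanSpace.real_norm_sq_eq, Fintype.sum_prod_type, Finset.sum_comm]
  simp [Matrix.trace, Matrix.mul_apply, pow_two]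

/-- The embedding of `O_d` into the Euclidean space of matrices. -/
def orthVec (Q : Orth d) : EuclideanSpace ℝ (Fin d × Fin d) := matVec Q.1

theorem range_orthVec : Set.range (orthVec (d := d)) = orthogonalSet d := by
  ext x
  constructor
  · rintro ⟨Q, rfl⟩
    exact Q.2
  · intro h
    exact ⟨⟨_, h⟩, rfl⟩

theorem continuous_orthVec : Continuous (orthVec (d := d)) := by
  refine (PiLp.continuous_toLp 2 _).comp (continuous_pi fun k => ?_)
  exact continuous_subtype_val.matrix_elem k.1 k.2

theorem orthVec_injective : Function.Injective (orthVec (d := d)) := by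
  intro P Q h
  refine Subtype.ext (Matrix.ext fun i j => ?_)
  exact congrArg (fun x : EuclideanSpace ℝ (Fin d × Fin d) => x (i, j)) h

theorem orthVec_equivariant (g : Orth d) : ∃ T : EuclideanSpace ℝ (Fin d × Fin d) →
    EuclideanSpace ℝ (Fin d × Fin d), Isometry T ∧ ∀ h, orthVec (g * h) = T (orthVec h) := by
  refine ⟨fun x => matVec (g.1 * Matrix.of fun i j => x (i, j)),
    Isometry.of_dist_eq fun x y => ?_, fun h => rfl⟩
  have h1 : matVec (g.1 * Matrix.of fun i j => x (i, j)) -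
      matVec (g.1 * Matrix.of fun i j => y (i, j)) =
      matVec (g.1 * Matrix.of fun i j => (x - y) (i, j)) := by
    ext k
    simp [Matrix.mul_apply, mul_sub]
  rw [dist_eq_norm, dist_eq_norm, h1, ← sq_eq_sq₀ (norm_nonneg _) (norm_nonneg _), norm_matVec_sq,
    Matrix.transpose_mul, mul_assoc, ← mul_assoc (g.1)ᵀ, g.transpose_mul_self, one_mul,
    ← norm_matVec_sq]
  rfl

end OrthogonalGroup

/-! ### Skew-symmetric coordinates and the Cayley chart of the orthogonal group -/

section Skew

/-- Positions strictly above the diagonal. -/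
abbrev UpperPair (d : ℕ) : Type := {k : Fin d × Fin d // k.1 < k.2}

theorem sum_upperPair {d : ℕ} {R : Type*} [AddCommMonoid R] (f : Fin d → Fin d → R) :
    ∑ k : UpperPair d, f k.1.1 k.1.2 = ∑ i, ∑ j ∈ Finset.Ioi i, f i j := by
  rw [← Finset.sum_subtype (Finset.univ.filter fun k : Fin d × Fin d => k.1 < k.2) (by simp)
    (fun k => f k.1 k.2), Finset.sum_filter, Fintype.sum_prod_type]
  refine Finset.sum_congr rfl fun i _ => ?_
  rw [← Finset.sum_filter]
  congr 1
  ext j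
  simp

/-- Matches the dimension of the chart with the dimension in the volume of `O_d`. -/
theorem card_upperPair (d : ℕ) : Fintype.card (UpperPair d) = dimO d := by
  have h := sum_upperPair (d := d) (fun _ _ => 1)
  simp only [Finset.sum_const, Finset.card_univ, smul_eq_mul, mul_one, Fin.card_Ioi] at h
  rw [h, dimO, Fin.sum_univ_eq_sum_range (fun i => d - 1 - i) d, Finset.sum_range_reflect
    (fun i => i) d, Finset.sum_range_id]

variable {d : ℕ}

/-- The entry functionals of the skew-symmetric matrix with given upper triangular part. -/
noncomputable def skewEntry (a b : Fin d) : EuclideanSpace ℝ (UpperPair d) →L[ℝ] ℝ :=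
  if h : a < b then EuclideanSpace.proj ⟨(a, b), h⟩
  else if h : b < a then -EuclideanSpace.proj ⟨(b, a), h⟩ else 0

/-- The skew-symmetric matrix with given upper triangular part. -/
noncomputable def skew : EuclideanSpace ℝ (UpperPair d) →ₗ[ℝ] Matrix (Fin d) (Fin d) ℝ where
  toFun x := Matrix.of fun a b => skewEntry a b x
  map_add' x y := by ext; simp
  map_smul' r x := by ext; simp

theorem skew_apply (x : EuclideanSpace ℝ (UpperPair d)) (a b : Fin d) :
    skew x a b = skewEntry a b x := rfl

theorem skewEntry_swap (a b : Fin d) : skewEntry b a = -skewEntry a b := by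
  rcases lt_trichotomy a b with h | rfl | h
  · simp [skewEntry, h, h.not_gt]
  · simp [skewEntry]
  · simp [skewEntry, h, h.not_gt]

theorem transpose_skew (x : EuclideanSpace ℝ (UpperPair d)) : (skew x)ᵀ = -skew x := by
  ext a b
  simp [skew_apply, skewEntry_swap a b]

theorem skew_of_entries {A : Matrix (Fin d) (Fin d) ℝ} (hA : Aᵀ = -A) :
    skew (WithLp.toLp 2 fun k : UpperPair d => A k.1.1 k.1.2) = A := by
  have hA' : ∀ a b, A b a = -A a b := fun a b => congrFun (congrFun hA a) b
  ext a b
  rcases lt_trichotomy a b with h | rfl | h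
  · simp [skew_apply, skewEntry, h]
  · have := hA' a a
    simp [skew_apply, skewEntry]
    linarith
  · simp [skew_apply, skewEntry, h, h.not_gt, hA' b a]

/-- Summation of products of entries of the elementary skew-symmetric matrices. -/
theorem sum_skewEntry_single (w : Fin d → Fin d → ℝ) (k l : UpperPair d) :
    ∑ a, ∑ b, w a b * (skewEntry a b (EuclideanSpace.single k 1) *
      skewEntry a b (EuclideanSpace.single l 1)) =
      if k = l then w k.1.1 k.1.2 + w k.1.2 k.1.1 else 0 := by
  have hs : ∀ (k : UpperPair d) a b, skewEntry a b (EuclideanSpace.single k (1 : ℝ)) =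
      (if a = k.1.1 then if b = k.1.2 then 1 else 0 else 0) -
      (if a = k.1.2 then if b = k.1.1 then 1 else 0 else 0) := by
    rintro ⟨⟨i, j⟩, hij⟩ a b
    simp only [skewEntry]
    split_ifs <;> simp_all [Subtype.ext_iff, Prod.ext_iff] <;> grind
  obtain ⟨⟨i, j⟩, hij⟩ := k
  obtain ⟨⟨i', j'⟩, hij'⟩ := l
  simp only [hs, mul_sub, Finset.sum_sub_distrib, mul_ite, mul_one, mul_zero, Finset.sum_ite_eq', Finset.mem_univ, if_true, Finset.sum_const_zero,
    Finset.sum_ite_irrel]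
  simp only [Subtype.ext_iff, Prod.ext_iff]
  dsimp only at hij hij'
  split_ifs <;> grind

/-- The chart of the orthogonal group given by the Cayley transform. -/
noncomputable def orthChart (x : EuclideanSpace ℝ (UpperPair d)) : Orth d :=
  ⟨cayley ((1 / 2 : ℝ) • skew x), cayley_mem_orthogonalGroup (by
    rw [Matrix.transpose_smul, transpose_skew, smul_neg])⟩

theorem continuous_skew : Continuous (skew (d := d)) :=
  continuous_matrix fun a b => (skewEntry a b).continuous

theorem continuousAt_matrix_inv {X : Type*} [TopologicalSpace X] {x₀ : X}
    {f : X → Matrix (Fin d) (Fin d) ℝ} (hf : Continuous f) (h : IsUnit (f x₀).det) :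
    ContinuousAt (fun x => (f x)⁻¹) x₀ := by
  simp only [Matrix.inv_def, Ring.inverse_eq_inv']
  exact (hf.matrix_det.continuousAt.inv₀ h.ne_zero).smul hf.matrix_adjugate.continuousAt

theorem continuous_orthChart : Continuous (orthChart (d := d)) := by
  refine Continuous.subtype_mk ?_ _
  have hB : Continuous fun x => (1 / 2 : ℝ) • skew (d := d) x := (continuous_const_smul _).comp continuous_skew
  refine (continuous_const.add hB).mul (continuous_iff_continuousAt.2 fun x => ?_)
  refine continuousAt_matrix_inv (continuous_const.sub hB) ?_
  exact isUnit_det_one_sub_of_skew (by rw [Matrix.transpose_smul, transpose_skew, smul_neg])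

/-- The inverse Cayley transform is defined and continuous near 1, where `1 + Q` is invertible, so
every `Q` close to 1 is the chart image of a point of `t`. -/
theorem orthChart_image_mem_nhds {t : Set (EuclideanSpace ℝ (UpperPair d))} (ht : t ∈ 𝓝 0) :
    orthChart '' t ∈ 𝓝 1 := by
  let ψ : Orth d → EuclideanSpace ℝ (UpperPair d) := fun Q =>
    WithLp.toLp 2 fun k => ((2 : ℝ) • cayleyInv Q.1) k.1.1 k.1.2
  have hadd : Continuous fun Q : Orth d => 1 + Q.1 := continuous_const.add continuous_subtype_val
  have h1 : IsUnit (1 + (1 : Orth d).1).det := by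
    rw [isUnit_iff_ne_zero, OneMemClass.coe_one, ← two_smul ℝ (1 : Matrix (Fin d) (Fin d) ℝ),
      Matrix.det_smul, Matrix.det_one]
    positivity
  have hψ0 : ψ 1 = 0 := by
    ext k
    simp [ψ, cayleyInv]
  have hψ : ContinuousAt ψ 1 := by
    refine (PiLp.continuous_toLp 2 _).continuousAt.comp (continuousAt_pi.2 fun k => ?_)
    have : ContinuousAt (fun Q : Orth d => (2 : ℝ) • cayleyInv Q.1) 1 :=
      (continuous_const_smul (2 : ℝ)).continuousAt.comp
        ((continuous_subtype_val.sub continuous_const).continuousAt.mul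
          (continuousAt_matrix_inv hadd h1))
    exact (continuous_id.matrix_elem k.1.1 k.1.2).continuousAt.comp this
  have hdet : ∀ᶠ Q : Orth d in 𝓝 1, IsUnit (1 + Q.1).det := by
    simp only [isUnit_iff_ne_zero] at h1 ⊢
    exact hadd.matrix_det.continuousAt.eventually_ne h1
  have hmem : ∀ᶠ Q : Orth d in 𝓝 1, ψ Q ∈ t := hψ (by rwa [hψ0])
  filter_upwards [hdet, hmem] with Q hQ hQt
  refine ⟨ψ Q, hQt, Subtype.ext ?_⟩
  change cayley ((1 / 2 : ℝ) • skew (ψ Q)) = Q.1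
  rw [skew_of_entries, smul_smul]
  · norm_num [cayley_cayleyInv hQ]
  · rw [Matrix.transpose_smul, transpose_cayleyInv Q.2 hQ, smul_neg]

theorem orthChart_zero : orthChart (0 : EuclideanSpace ℝ (UpperPair d)) = 1 :=
  Subtype.ext (by simp [orthChart, cayley])

/-- The factor `1 / 2` in the chart absorbs the 2 in the derivative of the Cayley transform. -/
theorem hasStrictFDerivAt_orthChart_apply (a b : Fin d) :
    HasStrictFDerivAt (fun x => (orthChart x).1 a b) (skewEntry a b) 0 :=
  hasStrictFDerivAt_cayley_apply ((1 / 2 : ℝ) • skew) a b fun x => by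
    simp [← skew_apply]

end Skew

/-! ### Determinant of a tridiagonal Toeplitz matrix -/

section Tridiagonal

/-- The tridiagonal Toeplitz matrix with diagonal `x² + y²` and off-diagonal `-xy`. -/
def tridiag (M : ℕ) (x y : ℝ) : Matrix (Fin M) (Fin M) ℝ := Matrix.of fun p q =>
  (if p = q then x ^ 2 + y ^ 2 else 0) -
    x * y * ((if p.castSucc = q.succ then 1 else 0) + if p.succ = q.castSucc then 1 else 0)

theorem tridiag_succ_succ (M : ℕ) (x y : ℝ) (p q : Fin M) :
    tridiag (M + 1) x y p.succ q.succ = tridiag M x y p q := by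
  simp [tridiag, Fin.ext_iff]

/-- Laplace expansion along the first row. The minor of the off-diagonal entry is expanded in turn
along its first column, whose only possibly nonzero entry is `-x y`. -/
theorem det_tridiag_add_two (M : ℕ) (x y : ℝ) : (tridiag (M + 2) x y).det =
    (x ^ 2 + y ^ 2) * (tridiag (M + 1) x y).det - (x * y) ^ 2 * (tridiag M x y).det := by
  have h0 : (tridiag (M + 2) x y).submatrix Fin.succ (Fin.succAbove 0) = tridiag (M + 1) x y := by
    ext p q
    simp [tridiag_succ_succ]
  have h1 : ((tridiag (M + 2) x y).submatrix Fin.succ (Fin.succAbove (Fin.succ 0))).det =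
      -(x * y) * (tridiag M x y).det := by
    rw [Matrix.det_succ_column_zero, Fin.sum_univ_succ, Finset.sum_eq_zero, add_zero]
    · have hm : ((tridiag (M + 2) x y).submatrix Fin.succ (Fin.succAbove (Fin.succ 0))).submatrix
          (Fin.succAbove 0) Fin.succ = tridiag M x y := by
        ext p q
        simp only [Matrix.submatrix_apply, Fin.succ_succAbove_succ, Fin.zero_succAbove,
          tridiag_succ_succ]
      rw [hm]
      simp [tridiag, Fin.ext_iff]
    · intro p _
      simp [tridiag, Fin.ext_iff]
  rw [Matrix.det_succ_row_zero, Fin.sum_univ_succ, Fin.sum_univ_succ, Finset.sum_eq_zero, add_zero,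
    h0, h1]
  · simp [tridiag, Fin.ext_iff]
    ring
  · intro p _
    simp [tridiag, Fin.ext_iff]

/-- The recurrence has characteristic roots `x²` and `y²`. The product form avoids division. -/
theorem det_tridiag_mul (M : ℕ) (x y : ℝ) : (tridiag M x y).det * (x ^ 2 - y ^ 2) =
    (x ^ 2) ^ (M + 1) - (y ^ 2) ^ (M + 1) := by
  induction M using Nat.twoStepInduction with
  | zero => simp
  | one =>
    rw [Matrix.det_fin_one]
    simp [tridiag, Fin.ext_iff]
    ring
  | more M h1 h2 =>
    rw [det_tridiag_add_two, sub_mul, mul_assoc, h2, mul_assoc, h1]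
    ring

end Tridiagonal

/-! ### Orthogonal action on layers and the parametrization of the fiber -/

section Orbit

variable {N M d : ℕ}

/-- The action of tuples of orthogonal matrices on the parameter space,
`W_p ↦ R_{p+1} W_p R_pᵀ`. -/
def act (R : Fin (N + 1) → Orth d) (W : ParamSpace N d) : ParamSpace N d :=
  WithLp.toLp 2 fun k => ((R k.1.succ).1 * layer W k.1 * (R k.1.castSucc).1ᵀ) k.2.1 k.2.2

theorem layer_act (R : Fin (N + 1) → Orth d) (W : ParamSpace N d) (p : Fin N) :
    layer (act R W) p = (R p.succ).1 * layer W p * (R p.castSucc).1ᵀ := rfl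

theorem ext_layer {W W' : ParamSpace N d} (h : ∀ p, layer W p = layer W' p) : W = W' := by
  ext ⟨p, i, j⟩
  exact congrFun (congrFun (h p) i) j

theorem act_mul (R R' : Fin (N + 1) → Orth d) (W : ParamSpace N d) :
    act (R * R') W = act R (act R' W) := by
  refine ext_layer fun p => ?_
  simp only [layer_act, Pi.mul_apply, Submonoid.coe_mul, Matrix.transpose_mul, mul_assoc]

theorem isometry_act (R : Fin (N + 1) → Orth d) : Isometry (act R) := by
  refine Isometry.of_dist_eq fun W W' => ?_
  have h1 : act R W - act R W' = act R (W - W') := by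
    refine ext_layer fun p => ?_
    have hs : ∀ W W' : ParamSpace N d, layer (W - W') p = layer W p - layer W' p := fun _ _ => rfl
    rw [hs, layer_act, layer_act, layer_act, hs, mul_sub, sub_mul]
  rw [dist_eq_norm, dist_eq_norm, h1, ← sq_eq_sq₀ (norm_nonneg _) (norm_nonneg _),
    normSq_eq_sum_trace, normSq_eq_sum_trace]
  refine Finset.sum_congr rfl fun p _ => ?_
  rw [layer_act, Matrix.transpose_mul, Matrix.transpose_mul, Matrix.transpose_transpose,
    Matrix.trace_mul_comm]
  simp only [mul_assoc]
  rw [← mul_assoc (R p.castSucc).1ᵀ, Orth.transpose_mul_self, one_mul, Matrix.trace_mul_comm,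
    mul_assoc, mul_assoc, Orth.transpose_mul_self, mul_one, Matrix.trace_mul_comm]

/-- The point all of whose layers are the same diagonal matrix. -/
def diagPoint (N : ℕ) (lam : Fin d → ℝ) : ParamSpace N d :=
  WithLp.toLp 2 fun k => Matrix.diagonal lam k.2.1 k.2.2

theorem layer_diagPoint (lam : Fin d → ℝ) (p : Fin N) :
    layer (diagPoint N lam) p = Matrix.diagonal lam := rfl

/-- Extension of a tuple of orthogonal matrices by prescribed end points. -/
def pad (V U : Orth d) (Q : Fin M → Orth d) : Fin (M + 2) → Orth d :=
  Fin.cons (α := fun _ => Orth d) V (Fin.snoc (α := fun _ => Orth d) Q U)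

theorem pad_zero (V U : Orth d) (Q : Fin M → Orth d) : pad V U Q 0 = V := rfl

theorem pad_last (V U : Orth d) (Q : Fin M → Orth d) : pad V U Q (Fin.last M).succ = U := by
  simp [pad]

theorem pad_castSucc_succ (V U : Orth d) (Q : Fin M → Orth d) (p : Fin M) :
    pad V U Q p.castSucc.succ = Q p := by
  simp [pad]

theorem pad_mul (V U V' U' : Orth d) (Q Q' : Fin M → Orth d) :
    pad V U Q * pad V' U' Q' = pad (V * V') (U * U') (Q * Q') := by
  funext q
  cases q using Fin.cases with
  | zero => rfl
  | succ q =>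
    cases q using Fin.lastCases with
    | last => simp only [Pi.mul_apply, pad_last]
    | cast p => simp only [Pi.mul_apply, pad_castSucc_succ]

/-- The parametrization of the balanced fiber over a diagonal matrix. -/
def orbitMap (lam : Fin d → ℝ) (Q : Fin M → Orth d) : ParamSpace (M + 1) d :=
  act (pad 1 1 Q) (diagPoint (M + 1) lam)

theorem continuous_pad_apply (q : Fin (M + 2)) :
    Continuous fun Q : Fin M → Orth d => pad 1 1 Q q := by
  cases q using Fin.cases with
  | zero => exact continuous_const
  | succ q =>
    cases q using Fin.lastCases with
    | last => simp only [pad_last]; exact continuous_const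
    | cast p => simp only [pad_castSucc_succ]; exact continuous_apply p

theorem continuous_orbitMap (lam : Fin d → ℝ) : Continuous (orbitMap (M := M) lam) := by
  refine (PiLp.continuous_toLp 2 _).comp (continuous_pi fun k => ?_)
  refine Continuous.matrix_elem ?_ _ _
  exact ((continuous_subtype_val.comp (continuous_pad_apply _)).mul continuous_const).mul
    (continuous_subtype_val.comp (continuous_pad_apply _)).matrix_transpose

theorem isUnit_det_diagonal {lam : Fin d → ℝ} (h : ∀ i, 0 < lam i) :
    IsUnit (Matrix.diagonal lam).det := by
  rw [Matrix.det_diagonal, isUnit_iff_ne_zero]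
  exact Finset.prod_ne_zero_iff.2 fun i _ => (h i).ne'

/-- The left end is fixed at 1 and `Λ` is invertible, so each layer determines the next orthogonal
factor from the previous one. -/
theorem orbitMap_injective {lam : Fin d → ℝ} (h : ∀ i, 0 < lam i) :
    Function.Injective (orbitMap (M := M) lam) := by
  intro P Q hPQ
  have hlayer : ∀ p : Fin (M + 1),
      (pad 1 1 P p.succ).1 * Matrix.diagonal lam * (pad 1 1 P p.castSucc).1ᵀ =
      (pad 1 1 Q p.succ).1 * Matrix.diagonal lam * (pad 1 1 Q p.castSucc).1ᵀ := fun p =>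
    congrArg (fun W => layer W p) hPQ
  have hpad : ∀ q, pad 1 1 P q = pad 1 1 Q q := by
    intro q
    induction q using Fin.induction with
    | zero => rfl
    | succ p ih =>
      have h1 := hlayer p
      rw [ih] at h1
      have h2 := congrArg (fun A => A * (pad 1 1 Q p.castSucc).1 * (Matrix.diagonal lam)⁻¹) h1
      simp only [mul_assoc] at h2
      rw [← mul_assoc _ (pad 1 1 Q p.castSucc).1, Orth.transpose_mul_self, one_mul,
        Matrix.mul_nonsing_inv _ (isUnit_det_diagonal h), mul_one, mul_one] at h2
      exact Subtype.ext h2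
  funext p
  simpa [pad_castSucc_succ] using hpad p.castSucc.succ

theorem orbitMap_equivariant (lam : Fin d → ℝ) (g : Fin M → Orth d) :
    ∃ T : ParamSpace (M + 1) d → ParamSpace (M + 1) d, Isometry T ∧
      ∀ h, orbitMap lam (g * h) = T (orbitMap lam h) :=
  ⟨act (pad 1 1 g), isometry_act _, fun h => by
    rw [orbitMap, orbitMap, ← act_mul, pad_mul, one_mul]⟩

end Orbit

/-! ### Differentials at the identity and their Gram matrices -/

section Derivative

variable {M d : ℕ}

theorem inner_eq_sum {ι : Type*} [Fintype ι] (x y : EuclideanSpace ℝ ι) :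
    inner ℝ x y = ∑ i, x i * y i := by
  simp [PiLp.inner_apply, mul_comm]

/-- The derivative of the embedding of the orthogonal group in the Cayley chart. -/
noncomputable def orthDeriv (d : ℕ) :
    EuclideanSpace ℝ (UpperPair d) →L[ℝ] EuclideanSpace ℝ (Fin d × Fin d) :=
  (PiLp.continuousLinearEquiv 2 ℝ fun _ : Fin d × Fin d => ℝ).symm.toContinuousLinearMap.comp
    (ContinuousLinearMap.pi fun k => skewEntry k.1 k.2)

theorem orthDeriv_apply (x : EuclideanSpace ℝ (UpperPair d)) (k : Fin d × Fin d) :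
    orthDeriv d x k = skewEntry k.1 k.2 x := rfl

theorem hasStrictFDerivAt_orthVec_orthChart :
    HasStrictFDerivAt (orthVec ∘ orthChart (d := d)) (orthDeriv d) 0 := by
  rw [hasStrictFDerivAt_euclidean]
  exact fun k => hasStrictFDerivAt_orthChart_apply k.1 k.2

/-- Each elementary skew matrix has entries `1` and `-1`, so the basis images are orthogonal with
squared length 2. -/
theorem normDet_orthDeriv_sq (d : ℕ) :
    (orthDeriv d).toLinearMap.normDet ^ 2 = 2 ^ Fintype.card (UpperPair d) := by
  have h := (orthDeriv d).toLinearMap.normDet_sq_eq_det_gram (EuclideanSpace.basisFun _ ℝ)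
  have hg : (Matrix.gram ℝ fun k => (orthDeriv d).toLinearMap
      (EuclideanSpace.basisFun (UpperPair d) ℝ k)) = (2 : ℝ) • 1 := by
    ext k l
    rw [Matrix.gram_apply, inner_eq_sum, Fintype.sum_prod_type]
    have := sum_skewEntry_single (fun _ _ => 1) k l
    simp only [one_mul] at this
    simp only [EuclideanSpace.basisFun_apply, ContinuousLinearMap.coe_coe, orthDeriv_apply,
      this, Matrix.smul_apply, Matrix.one_apply]
    norm_num
  rw [hg, Matrix.det_smul, Matrix.det_one, mul_one] at h
  exact_mod_cast h

/-- The `p`-th block of coordinates. -/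
noncomputable def block (κ : Type*) [Fintype κ] (p : Fin M) :
    EuclideanSpace ℝ (Fin M × κ) →L[ℝ] EuclideanSpace ℝ κ :=
  (PiLp.continuousLinearEquiv 2 ℝ fun _ : κ => ℝ).symm.toContinuousLinearMap.comp
    (ContinuousLinearMap.pi fun k => EuclideanSpace.proj (p, k))

theorem block_single {κ : Type*} [Fintype κ] [DecidableEq κ] (p p' : Fin M) (k : κ) :
    block κ p' (EuclideanSpace.single (p, k) (1 : ℝ)) =
      if p' = p then EuclideanSpace.single k 1 else 0 := by
  ext l
  change (EuclideanSpace.single (p, k) (1 : ℝ)) (p', l) = _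
  split_ifs with h <;> simp [h, Prod.ext_iff]

/-- The derivative of an entry of the padded tuple of Cayley charts. -/
noncomputable def padDeriv (a b : Fin d) :
    Fin (M + 2) → EuclideanSpace ℝ (Fin M × UpperPair d) →L[ℝ] ℝ :=
  Fin.cons (α := fun _ => EuclideanSpace ℝ (Fin M × UpperPair d) →L[ℝ] ℝ) 0
    (Fin.snoc (α := fun _ => EuclideanSpace ℝ (Fin M × UpperPair d) →L[ℝ] ℝ)
      (fun p => (skewEntry a b).comp (block _ p)) 0)

theorem padDeriv_last (a b : Fin d) : padDeriv (M := M) a b (Fin.last M).succ = 0 := by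
  simp [padDeriv]

theorem padDeriv_castSucc_succ (a b : Fin d) (p : Fin M) :
    padDeriv a b p.castSucc.succ = (skewEntry a b).comp (block _ p) := by
  simp [padDeriv]

theorem padDeriv_swap (a b : Fin d) (q : Fin (M + 2)) : padDeriv b a q = -padDeriv a b q := by
  cases q using Fin.cases with
  | zero => simp [padDeriv]
  | succ q =>
    cases q using Fin.lastCases with
    | last => rw [padDeriv_last, padDeriv_last, neg_zero]
    | cast p => rw [padDeriv_castSucc_succ, padDeriv_castSucc_succ, skewEntry_swap]; rfl

theorem padDeriv_succ_single (a b : Fin d) (q : Fin (M + 1)) (p : Fin M) (k : UpperPair d) :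
    padDeriv a b q.succ (EuclideanSpace.single (p, k) 1) =
      if q = p.castSucc then skewEntry a b (EuclideanSpace.single k 1) else 0 := by
  cases q using Fin.lastCases with
  | last => rw [padDeriv_last, if_neg (Fin.castSucc_lt_last p).ne']; rfl
  | cast p' =>
    rw [padDeriv_castSucc_succ, ContinuousLinearMap.comp_apply, block_single]
    simp only [Fin.castSucc_inj]
    split_ifs <;> simp

theorem padDeriv_castSucc_single (a b : Fin d) (q : Fin (M + 1)) (p : Fin M) (k : UpperPair d) :
    padDeriv a b q.castSucc (EuclideanSpace.single (p, k) 1) =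
      if q = p.succ then skewEntry a b (EuclideanSpace.single k 1) else 0 := by
  cases q using Fin.cases with
  | zero => simp [padDeriv, (Fin.succ_ne_zero p).symm]
  | succ p' =>
    rw [← Fin.succ_castSucc, padDeriv_castSucc_succ, ContinuousLinearMap.comp_apply, block_single]
    simp only [Fin.succ_inj]
    split_ifs <;> simp

theorem hasStrictFDerivAt_pad (a b : Fin d) (q : Fin (M + 2)) :
    HasStrictFDerivAt (fun x => (pad 1 1 (piChart M orthChart x) q).1 a b) (padDeriv a b q) 0 := by
  cases q using Fin.cases with
  | zero => exact hasStrictFDerivAt_const _ _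
  | succ q =>
    cases q using Fin.lastCases with
    | last =>
      simp only [pad_last, padDeriv_last]
      exact hasStrictFDerivAt_const _ _
    | cast p =>
      simp only [pad_castSucc_succ, padDeriv_castSucc_succ]
      have h := hasStrictFDerivAt_orthChart_apply a b
      rw [← map_zero (block (UpperPair d) p)] at h
      exact h.comp (0 : EuclideanSpace ℝ (Fin M × UpperPair d))
        (block (UpperPair d) p).hasStrictFDerivAt

theorem pad_piChart_zero (q : Fin (M + 2)) :
    pad 1 1 (piChart M (orthChart (d := d)) 0) q = 1 := by
  have h : piChart M (orthChart (d := d)) 0 = 1 := by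
    funext p
    exact orthChart_zero
  rw [h]
  cases q using Fin.cases with
  | zero => rfl
  | succ q =>
    cases q using Fin.lastCases with
    | last => rw [pad_last]
    | cast p => rw [pad_castSucc_succ]; rfl

/-- The derivative of the parametrization of the balanced fiber in the Cayley charts. -/
noncomputable def orbitDeriv (M : ℕ) (lam : Fin d → ℝ) :
    EuclideanSpace ℝ (Fin M × UpperPair d) →L[ℝ] ParamSpace (M + 1) d :=
  (PiLp.continuousLinearEquiv 2 ℝ
    fun _ : Fin (M + 1) × Fin d × Fin d => ℝ).symm.toContinuousLinearMap.comp
    (ContinuousLinearMap.pi fun k => lam k.2.2 • padDeriv k.2.1 k.2.2 k.1.succ -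
      lam k.2.1 • padDeriv k.2.1 k.2.2 k.1.castSucc)

theorem hasStrictFDerivAt_orbitMap (lam : Fin d → ℝ) :
    HasStrictFDerivAt (orbitMap lam ∘ piChart M orthChart) (orbitDeriv M lam) 0 := by
  rw [hasStrictFDerivAt_euclidean]
  rintro ⟨q, a, b⟩
  -- Product rule for the entry `(a, b)` of `R_{q+1} Λ R_qᵀ`, all factors `R` being 1 at the base
  -- point. Skew-symmetry later turns the transposed factor into a minus sign.
  have h1 : HasStrictFDerivAt (fun x => ∑ c, (pad 1 1 (piChart M orthChart x) q.succ).1 a c *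
      lam c * (pad 1 1 (piChart M orthChart x) q.castSucc).1 b c)
      (∑ c, ((1 : Matrix (Fin d) (Fin d) ℝ) a c * lam c) • padDeriv b c q.castSucc +
        ∑ c, (1 : Matrix (Fin d) (Fin d) ℝ) b c • lam c • padDeriv a c q.succ) 0 := by
    rw [← Finset.sum_add_distrib]
    refine HasStrictFDerivAt.fun_sum fun c _ => ?_
    have := ((hasStrictFDerivAt_pad (M := M) a c q.succ).mul_const (lam c)).mul
      (hasStrictFDerivAt_pad b c q.castSucc)
    simp only [pad_piChart_zero] at this
    exact this
  refine (h1.congr_fderiv ?_).congr_of_eventuallyEq ?_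
  · ext x
    simp only [Matrix.one_apply, ite_mul, one_mul, zero_mul, ite_smul, zero_smul, one_smul,
      Finset.sum_ite_eq, Finset.mem_univ, if_true]
    change lam a * padDeriv b a q.castSucc x + lam b * padDeriv a b q.succ x =
      lam b * padDeriv a b q.succ x - lam a * padDeriv a b q.castSucc x
    rw [padDeriv_swap a b]
    simp only [_root_.neg_apply]
    ring
  · refine Eventually.of_forall fun x => ?_
    change _ = ((pad 1 1 (piChart M orthChart x) q.succ).1 * Matrix.diagonal lam *
      (pad 1 1 (piChart M orthChart x) q.castSucc).1ᵀ) a b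
    rw [Matrix.mul_apply]
    simp only [Matrix.mul_diagonal, Matrix.transpose_apply]

/-- A tangent direction at slot `p` moves only the two layers adjacent to it, so distinct slots
interact only if they are neighbours. Distinct pairs `i < j` occupy disjoint matrix entries. The
entries `(i, j)` and `(j, i)` contribute equally, which gives the factor 2. -/
theorem gram_orbitDeriv (lam : Fin d → ℝ) :
    (Matrix.gram ℝ fun k => (orbitDeriv M lam).toLinearMap
      (EuclideanSpace.basisFun (Fin M × UpperPair d) ℝ k)) =
    Matrix.blockDiagonal fun k : UpperPair d => (2 : ℝ) • tridiag M (lam k.1.1) (lam k.1.2) := by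
  ext ⟨p, k⟩ ⟨p', l⟩
  rw [Matrix.gram_apply, inner_eq_sum, Fintype.sum_prod_type]
  -- Weight of the skew entry `(a, b)` at slot `p` in layer `q`: `λ_b` where it multiplies `Λ` on
  -- the left, `-λ_a` where it multiplies on the right.
  let C : Fin M → Fin (M + 1) → Fin d → Fin d → ℝ := fun p q a b =>
    (if q = p.castSucc then lam b else 0) - if q = p.succ then lam a else 0
  have hterm : ∀ q a b,
      (lam b * (if q = p.castSucc then skewEntry a b (EuclideanSpace.single k 1) else 0) -
        lam a * if q = p.succ then skewEntry a b (EuclideanSpace.single k 1) else 0) *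
      (lam b * (if q = p'.castSucc then skewEntry a b (EuclideanSpace.single l 1) else 0) -
        lam a * if q = p'.succ then skewEntry a b (EuclideanSpace.single l 1) else 0) =
      (C p q a b * C p' q a b) * (skewEntry a b (EuclideanSpace.single k 1) *
        skewEntry a b (EuclideanSpace.single l 1)) := by
    intro q a b
    simp only [C]
    split_ifs <;> ring
  have hC : ∀ a b, ∑ q, C p q a b * C p' q a b = tridiag M (lam a) (lam b) p p' := by
    intro a b
    simp only [C, sub_mul, mul_sub, ite_mul, mul_ite, zero_mul, mul_zero, Finset.sum_sub_distrib,
      Finset.sum_ite_eq', Finset.mem_univ, if_true, tridiag, Matrix.of_apply]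
    simp only [Fin.ext_iff, Fin.val_castSucc, Fin.val_succ]
    split_ifs <;> first | omega | ring
  have hsymm : ∀ x y, tridiag M x y p p' = tridiag M y x p p' := by
    intro x y
    simp only [tridiag, Matrix.of_apply, mul_comm x y, add_comm (x ^ 2)]
  have hsum : ∀ q, ∑ a, ∑ b, (C p q a b * C p' q a b) *
      (skewEntry a b (EuclideanSpace.single k 1) * skewEntry a b (EuclideanSpace.single l 1)) =
      if k = l then C p q k.1.1 k.1.2 * C p' q k.1.1 k.1.2 +
        C p q k.1.2 k.1.1 * C p' q k.1.2 k.1.1 else 0 := fun q =>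
    sum_skewEntry_single (fun a b => C p q a b * C p' q a b) k l
  calc _ = ∑ q, ∑ a, ∑ b, (C p q a b * C p' q a b) *
      (skewEntry a b (EuclideanSpace.single k 1) * skewEntry a b (EuclideanSpace.single l 1)) := by
        refine Finset.sum_congr rfl fun q _ => ?_
        rw [Fintype.sum_prod_type]
        refine Finset.sum_congr rfl fun a _ => Finset.sum_congr rfl fun b _ => ?_
        rw [← hterm, ← padDeriv_succ_single, ← padDeriv_castSucc_single, ← padDeriv_succ_single,
          ← padDeriv_castSucc_single, EuclideanSpace.basisFun_apply, EuclideanSpace.basisFun_apply]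
        rfl
    _ = if k = l then 2 * tridiag M (lam k.1.1) (lam k.1.2) p p' else 0 := by
        rw [Finset.sum_congr rfl fun q _ => hsum q]
        split_ifs
        · rw [Finset.sum_add_distrib, hC, hC, hsymm (lam k.1.2), two_mul]
        · exact Finset.sum_const_zero
    _ = _ := by
        rw [Matrix.blockDiagonal_apply]
        rfl

end Derivative

/-! ### Volume of the fiber over a diagonal matrix -/

section OrbitVolume

variable {d : ℕ}

theorem det_tridiag_eq_div (M : ℕ) {x y : ℝ} (hxy : y < x) (hy : 0 < y) :
    (tridiag M x y).det = ((x ^ 2) ^ (M + 1) - (y ^ 2) ^ (M + 1)) / (x ^ 2 - y ^ 2) := by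
  have : y ^ 2 < x ^ 2 := by gcongr
  rw [← det_tridiag_mul, mul_div_cancel_right₀ _ (sub_pos.2 this).ne']

theorem det_tridiag_pos (M : ℕ) {x y : ℝ} (hxy : y < x) (hy : 0 < y) :
    0 < (tridiag M x y).det := by
  rw [det_tridiag_eq_div M hxy hy]
  have h : y ^ 2 < x ^ 2 := by gcongr
  have h' : (y ^ 2) ^ (M + 1) < (x ^ 2) ^ (M + 1) := by gcongr
  exact div_pos (sub_pos.2 h') (sub_pos.2 h)

theorem injective_of_normDet_ne_zero {U V : Type*} [NormedAddCommGroup U] [InnerProductSpace ℝ U]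
    [FiniteDimensional ℝ U] [NormedAddCommGroup V] [InnerProductSpace ℝ V] {L : U →L[ℝ] V}
    (h : L.toLinearMap.normDet ≠ 0) : Function.Injective L := by
  by_contra hL
  exact h (LinearMap.normDet_eq_zero_iff_ker_ne_bot.2 fun hk => hL (LinearMap.ker_eq_bot.1 hk))

theorem volume_range_orbitMap (M : ℕ) {lam : Fin d → ℝ} (hpos : ∀ i, 0 < lam i)
    (hanti : StrictAnti lam) :
    0 < volO d ∧ volO d < ⊤ ∧ μHE[nStar (M + 1) d] (Set.range (orbitMap (M := M) lam)) =
      ENNReal.ofReal (√(∏ k : UpperPair d, (tridiag M (lam k.1.1) (lam k.1.2)).det)) *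
        volO d ^ M := by
  set P := ∏ k : UpperPair d, (tridiag M (lam k.1.1) (lam k.1.2)).det with hP
  have hP0 : 0 < P := Finset.prod_pos fun k _ => det_tridiag_pos M (hanti k.2) (hpos _)
  set J := (orthDeriv d).toLinearMap.normDet with hJ
  set J' := (orbitDeriv M lam).toLinearMap.normDet with hJ'
  have hJ2 : J ^ 2 = 2 ^ Fintype.card (UpperPair d) := normDet_orthDeriv_sq d
  -- Each `M × M` block contributes `2 ^ M`; over all pairs this is exactly `(J ^ M) ^ 2`.
  have hJ2' : J' ^ 2 = (J ^ M) ^ 2 * P := by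
    have h := (orbitDeriv M lam).toLinearMap.normDet_sq_eq_det_gram (EuclideanSpace.basisFun _ ℝ)
    rw [gram_orbitDeriv, Matrix.det_blockDiagonal] at h
    simp only [Matrix.det_smul, Finset.prod_mul_distrib, Finset.prod_const, Finset.card_univ,
      Fintype.card_fin] at h
    rw [← pow_mul, mul_comm M, pow_mul, hJ2, ← pow_mul, mul_comm _ M, pow_mul]
    exact_mod_cast h
  have hJ0 : 0 ≤ J := LinearMap.normDet_nonneg _
  have hJne : J ≠ 0 := fun h => by
    rw [h] at hJ2
    exact (pow_ne_zero (M₀ := ℝ) _ two_ne_zero) (hJ2.symm.trans (zero_pow two_ne_zero))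
  have hJeq : J' = √P * J ^ M := by
    rw [← sq_eq_sq₀ (LinearMap.normDet_nonneg _) (by positivity), hJ2', mul_pow,
      Real.sq_sqrt hP0.le, mul_comm]
  have hJne' : J' ≠ 0 := by
    rw [hJeq]
    exact mul_ne_zero (Real.sqrt_pos.2 hP0).ne' (pow_ne_zero _ hJne)
  obtain ⟨h1, h2, h3⟩ := volume_orbit_pow (M := M) continuous_orthVec orthVec_injective
    orthVec_equivariant (continuous_orbitMap lam) (orbitMap_injective hpos)
    (orbitMap_equivariant lam) continuous_orthChart
    (fun r hr => orthChart_image_mem_nhds (cube_mem_nhds _ hr))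
    hasStrictFDerivAt_orthVec_orthChart (injective_of_normDet_ne_zero hJne)
    (hasStrictFDerivAt_orbitMap lam) (injective_of_normDet_ne_zero hJne')
  rw [card_upperPair, range_orthVec] at h1 h2 h3
  refine ⟨h1, h2, ?_⟩
  have hJM : ENNReal.ofReal J ^ M ≠ 0 := pow_ne_zero _ (by simpa using hJ0.lt_of_ne' hJne)
  rw [← hJ, ← hJ', hJeq, ENNReal.ofReal_mul (Real.sqrt_nonneg _), ENNReal.ofReal_pow hJ0,
    mul_right_comm] at h3
  exact (ENNReal.mul_left_inj hJM (ENNReal.pow_ne_top ENNReal.ofReal_ne_top)).1 h3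

end OrbitVolume

/-! ### Singular value decomposition -/

section SingularValueDecomposition

variable {d : ℕ} {X : Matrix (Fin d) (Fin d) ℝ}

theorem mem_orthogonalGroup_of_orthonormal {u : Fin d → EuclideanSpace ℝ (Fin d)}
    (hu : Orthonormal ℝ u) : (Matrix.of fun i j => u j i) ∈ Matrix.orthogonalGroup (Fin d) ℝ := by
  rw [Matrix.mem_orthogonalGroup_iff']
  ext i j
  rw [Matrix.mul_apply, Matrix.one_apply, ← orthonormal_iff_ite.1 hu i j, inner_eq_sum]
  rfl

theorem sv_pos (hX : X.rank = d) (i : Fin d) : 0 < sv X i := by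
  have hinj : Function.Injective (Matrix.toEuclideanLin X) := by
    have hu : IsUnit X := by
      rw [Matrix.isUnit_iff_isUnit_det]
      by_contra h
      rw [isUnit_iff_ne_zero, not_not, ← Matrix.exists_mulVec_eq_zero_iff] at h
      obtain ⟨v, hv, hXv⟩ := h
      have hr := X.mulVecLin.finrank_range_add_finrank_ker
      rw [← Matrix.rank, hX] at hr
      simp at hr
      have := LinearMap.ker_eq_bot'.1 hr v hXv
      exact hv this
    intro x y hxy
    have := congrArg WithLp.ofLp hxy
    rw [Matrix.ofLp_toLpLin, Matrix.ofLp_toLpLin] at this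
    exact WithLp.ofLp_injective 2 (Matrix.mulVec_injective_of_isUnit hu this)
  exact LinearMap.injective_iff_forall_lt_finrank_singularValues_pos _ |>.1 hinj i (by simp)

theorem sv_strictAnti (hX : Function.Injective (sv X)) : StrictAnti (sv X) :=
  Antitone.strictAnti_of_injective (fun _ _ h =>
    (Matrix.toEuclideanLin X).singularValues_antitone h) hX

/-- The columns of `V` are an orthonormal eigenbasis `b_j` of `Xᵀ X`. The vectors `X b_j / σ_j` are
again orthonormal, with all `σ_j` nonzero by full rank, and form the columns of `U`. -/
theorem exists_svd (hX : X.rank = d) :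
    ∃ U V : Orth d, X = U.1 * Matrix.diagonal (sv X) * V.1ᵀ := by
  set T := Matrix.toEuclideanLin X with hT
  have hS := T.isSymmetric_adjoint_comp_self
  let b := hS.eigenvectorBasis (n := d) (by simp)
  have hbb : ∀ i j, inner ℝ (T (b i)) (T (b j)) = if i = j then sv X j ^ 2 else 0 := by
    intro i j
    rw [← LinearMap.adjoint_inner_right, ← LinearMap.comp_apply,
      hS.apply_eigenvectorBasis, inner_smul_right, orthonormal_iff_ite.1 b.orthonormal, sv,
      LinearMap.sq_singularValues_fin _ (by simp)]
    simp
  have hpos := sv_pos hX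
  have hu : Orthonormal ℝ fun j => (sv X j)⁻¹ • T (b j) := by
    rw [orthonormal_iff_ite]
    intro i j
    rw [inner_smul_left, inner_smul_right, hbb]
    split_ifs with h
    · subst h
      have := (hpos i).ne'
      simp
      field_simp
    · simp
  refine ⟨⟨_, mem_orthogonalGroup_of_orthonormal hu⟩,
    ⟨_, mem_orthogonalGroup_of_orthonormal b.orthonormal⟩, ?_⟩
  set V : Orth d := ⟨_, mem_orthogonalGroup_of_orthonormal b.orthonormal⟩ with hV
  have hXV : X * V.1 = (Matrix.of fun i j => ((sv X j)⁻¹ • T (b j)) i) *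
      Matrix.diagonal (sv X) := by
    ext i j
    rw [Matrix.mul_diagonal, Matrix.of_apply, PiLp.smul_apply, smul_eq_mul, mul_right_comm,
      inv_mul_cancel₀ (hpos j).ne', one_mul, hT, Matrix.ofLp_toLpLin]
    rfl
  rw [← hXV, mul_assoc, V.mul_transpose_self, mul_one]

end SingularValueDecomposition

/-! ### Description of the balanced fiber -/

section BalancedFiber

variable {d : ℕ}

/-- The product `A_{n-1} ⋯ A_0`. -/
def prodRev {n : ℕ} (A : Fin n → Matrix (Fin d) (Fin d) ℝ) : Matrix (Fin d) (Fin d) ℝ :=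
  (List.ofFn fun p : Fin n => A p.rev).prod

theorem prodRev_succ {n : ℕ} (A : Fin (n + 1) → Matrix (Fin d) (Fin d) ℝ) :
    prodRev A = A (Fin.last n) * prodRev fun p => A p.castSucc := by
  simp [prodRev, List.ofFn_succ, Fin.rev_succ]

theorem prodRev_succ' {n : ℕ} (A : Fin (n + 1) → Matrix (Fin d) (Fin d) ℝ) :
    prodRev A = prodRev (fun p => A p.succ) * A 0 := by
  rw [prodRev, List.ofFn_succ', List.prod_concat]
  simp only [Fin.rev_castSucc, Fin.rev_last, prodRev]

/-- The inner orthogonal factors telescope. -/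
theorem prodRev_conj {n : ℕ} (R : Fin (n + 1) → Orth d) (D : Matrix (Fin d) (Fin d) ℝ) :
    prodRev (fun p => (R p.succ).1 * D * (R p.castSucc).1ᵀ) =
      (R (Fin.last n)).1 * D ^ n * (R 0).1ᵀ := by
  induction n with
  | zero => simp [prodRev, Orth.mul_transpose_self]
  | succ n ih =>
    rw [prodRev_succ]
    simp only [Fin.succ_castSucc]
    rw [ih fun p => R p.castSucc, Fin.castSucc_zero, Fin.succ_last, pow_succ']
    simp only [mul_assoc]
    rw [← mul_assoc (R (Fin.last n).castSucc).1ᵀ, Orth.transpose_mul_self, one_mul]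

/-- Induction peels off the first factor: the remaining ones give `(A_1ᵀ A_1)^k = (A_0 A_0ᵀ)^k` by
balancedness, and `A_0ᵀ (A_0 A_0ᵀ)^k A_0 = (A_0ᵀ A_0)^{k+1}`. -/
theorem transpose_prodRev_mul_self {n : ℕ} (A : Fin (n + 1) → Matrix (Fin d) (Fin d) ℝ)
    (hA : ∀ p q : Fin (n + 1), (q : ℕ) = (p : ℕ) + 1 → (A q)ᵀ * A q = A p * (A p)ᵀ) :
    (prodRev A)ᵀ * prodRev A = ((A 0)ᵀ * A 0) ^ (n + 1) := by
  induction n with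
  | zero => simp [prodRev]
  | succ n ih =>
    have h := ih (fun p => A p.succ) fun p q hpq => hA _ _ (by simpa using hpq)
    have hpow : ∀ k, (A 0)ᵀ * (A 0 * (A 0)ᵀ) ^ k * A 0 = ((A 0)ᵀ * A 0) ^ (k + 1) := by
      intro k
      induction k with
      | zero => simp
      | succ k ihk => rw [pow_succ', pow_succ' _ (k + 1), ← ihk]; simp only [mul_assoc]
    rw [prodRev_succ', Matrix.transpose_mul, ← hpow, ← hA 0 (Fin.succ 0) (by simp), ← h]
    simp only [mul_assoc]

/-- Uniqueness of positive semidefinite roots of nonnegative diagonal matrices. -/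
theorem eq_diagonal_of_pow_eq {A : Matrix (Fin d) (Fin d) ℝ} (hA : A.PosSemidef) {e : Fin d → ℝ}
    (he : ∀ i, 0 ≤ e i) {n : ℕ} (hn : n ≠ 0) (h : A ^ n = Matrix.diagonal e ^ n) :
    A = Matrix.diagonal e := by
  let P : Orth d := hA.1.eigenvectorUnitary
  let f := hA.1.eigenvalues
  have hf : ∀ i, 0 ≤ f i := hA.eigenvalues_nonneg
  have hspec : P.1ᵀ * A = Matrix.diagonal f * P.1ᵀ := by
    have h1 : A = P.1 * Matrix.diagonal f * P.1ᵀ := by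
      conv_lhs => rw [hA.1.spectral_theorem]
      rfl
    conv_lhs => rw [h1]
    rw [mul_assoc, ← mul_assoc, P.transpose_mul_self, one_mul]
  have hpow : ∀ k, P.1ᵀ * A ^ k = Matrix.diagonal f ^ k * P.1ᵀ := by
    intro k
    induction k with
    | zero => simp
    | succ k ih => rw [pow_succ, ← mul_assoc, ih, mul_assoc, hspec, ← mul_assoc, pow_succ]
  -- Entrywise, `f_i^n` and `e_j^n` agree wherever `P.1ᵀ i j ≠ 0`. Nonnegativity then gives `f_i =
  -- e_j` there.
  have hent : Matrix.diagonal f * P.1ᵀ = P.1ᵀ * Matrix.diagonal e := by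
    ext i j
    have h1 := congrFun (congrFun (hpow n) i) j
    rw [h, Matrix.diagonal_pow, Matrix.diagonal_pow, Matrix.mul_diagonal, Matrix.diagonal_mul,
      Pi.pow_apply, Pi.pow_apply] at h1
    rw [Matrix.mul_diagonal, Matrix.diagonal_mul]
    by_cases h0 : P.1ᵀ i j = 0
    · rw [h0, mul_zero, zero_mul]
    · rw [mul_comm] at h1
      rw [(pow_left_inj₀ (he j) (hf i) hn).1 (mul_right_cancel₀ h0 h1), mul_comm]
  have h2 : P.1ᵀ * A = P.1ᵀ * Matrix.diagonal e := hspec.trans hent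
  have h3 := congrArg (fun B => P.1 * B) h2
  simpa only [← mul_assoc, P.mul_transpose_self, one_mul] using h3

theorem endToEnd_act_diagPoint {N : ℕ} (R : Fin (N + 1) → Orth d) (lam : Fin d → ℝ) :
    endToEnd (act R (diagPoint N lam)) =
      (R (Fin.last N)).1 * Matrix.diagonal lam ^ N * (R 0).1ᵀ :=
  prodRev_conj R (Matrix.diagonal lam)

theorem act_diagPoint_mem_balancedManifold {N : ℕ} (R : Fin (N + 1) → Orth d) {lam : Fin d → ℝ}
    (hpos : ∀ i, 0 < lam i) : act R (diagPoint N lam) ∈ balancedManifold N d := by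
  constructor
  · intro p q hpq
    have hR : R q.castSucc = R p.succ := congrArg R (Fin.ext (by simp [hpq]))
    simp only [layer_act, layer_diagPoint, Matrix.transpose_mul, Matrix.transpose_transpose, hR,
      Matrix.diagonal_transpose, mul_assoc]
    rw [← mul_assoc (R q.succ).1ᵀ, Orth.transpose_mul_self, one_mul,
      ← mul_assoc (R p.castSucc).1ᵀ, Orth.transpose_mul_self, one_mul]
  · intro p
    rw [layer_act, layer_diagPoint]
    have h1 : ∀ Q : Orth d, IsUnit Q.1.det := fun Q =>
      Matrix.isUnit_det_of_left_inverse Q.transpose_mul_self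
    rw [Matrix.rank_of_isUnit, Fintype.card_fin]
    rw [Matrix.isUnit_iff_isUnit_det, Matrix.det_mul, Matrix.det_mul, Matrix.det_transpose]
    exact ((h1 _).mul (isUnit_det_diagonal hpos)).mul (h1 _)

/-- The layers have aligned singular value decompositions: if `W_pᵀ W_p = R_p Λ² R_pᵀ`, then
`R_{p+1} = W_p R_p Λ⁻¹` is orthogonal, and balancedness transports the same identity to the next
layer. -/
theorem exists_eq_act_diagPoint {M : ℕ} {W : ParamSpace (M + 1) d} {lam : Fin d → ℝ}
    (hpos : ∀ i, 0 < lam i)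
    (hW : ∀ p q : Fin (M + 1), (q : ℕ) = (p : ℕ) + 1 →
      (layer W q)ᵀ * layer W q = layer W p * (layer W p)ᵀ)
    (V : Orth d) (hV : (layer W 0)ᵀ * layer W 0 =
      V.1 * (Matrix.diagonal lam * Matrix.diagonal lam) * V.1ᵀ) :
    ∃ R : Fin (M + 2) → Orth d, R 0 = V ∧ W = act R (diagPoint (M + 1) lam) := by
  set D := Matrix.diagonal lam with hD
  have hDu : IsUnit D.det := isUnit_det_diagonal hpos
  have hDt : Dᵀ = D := Matrix.diagonal_transpose _
  let r : Fin (M + 2) → Matrix (Fin d) (Fin d) ℝ :=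
    Fin.induction V.1 fun p s => layer W p * s * D⁻¹
  have hr : ∀ p, r p.succ = layer W p * r p.castSucc * D⁻¹ := fun p => Fin.induction_succ _ _ p
  have hstep : ∀ p, r p.castSucc ∈ Matrix.orthogonalGroup (Fin d) ℝ →
      (layer W p)ᵀ * layer W p = r p.castSucc * (D * D) * (r p.castSucc)ᵀ →
      r p.succ ∈ Matrix.orthogonalGroup (Fin d) ℝ ∧
        layer W p = r p.succ * D * (r p.castSucc)ᵀ := by
    intro p hp hWp
    have hp1 := (Matrix.mem_orthogonalGroup_iff' _ _).1 hp
    have hp2 := (Matrix.mem_orthogonalGroup_iff _ _).1 hp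
    change (r p.castSucc)ᵀ * r p.castSucc = 1 at hp1
    change r p.castSucc * (r p.castSucc)ᵀ = 1 at hp2
    constructor
    · rw [Matrix.mem_orthogonalGroup_iff', hr]
      rw [Matrix.transpose_mul, Matrix.transpose_mul, Matrix.transpose_nonsing_inv, hDt]
      calc D⁻¹ * ((r p.castSucc)ᵀ * (layer W p)ᵀ) * (layer W p * r p.castSucc * D⁻¹)
          = D⁻¹ * ((r p.castSucc)ᵀ * ((layer W p)ᵀ * layer W p) * r p.castSucc) * D⁻¹ := by
            simp only [mul_assoc]
        _ = D⁻¹ * ((((r p.castSucc)ᵀ * r p.castSucc) * (D * D)) *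
              ((r p.castSucc)ᵀ * r p.castSucc)) * D⁻¹ := by
            rw [hWp]; simp only [mul_assoc]
        _ = (D⁻¹ * D) * (D * D⁻¹) := by rw [hp1, one_mul, mul_one]; simp only [mul_assoc]
        _ = 1 := by rw [Matrix.nonsing_inv_mul _ hDu, Matrix.mul_nonsing_inv _ hDu, one_mul]
    · rw [hr, mul_assoc _ D⁻¹, Matrix.nonsing_inv_mul _ hDu, mul_one, mul_assoc, hp2, mul_one]
  have hall : ∀ p : Fin (M + 1), r p.castSucc ∈ Matrix.orthogonalGroup (Fin d) ℝ ∧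
      (layer W p)ᵀ * layer W p = r p.castSucc * (D * D) * (r p.castSucc)ᵀ := by
    intro p
    induction p using Fin.induction with
    | zero => exact ⟨V.2, hV⟩
    | succ p ih =>
      obtain ⟨h1, h2⟩ := hstep _ ih.1 ih.2
      rw [← Fin.succ_castSucc]
      refine ⟨h1, ?_⟩
      have h3 := (Matrix.mem_orthogonalGroup_iff' _ _).1 ih.1
      change (r p.castSucc.castSucc)ᵀ * r p.castSucc.castSucc = 1 at h3
      rw [hW p.castSucc p.succ (by simp), h2, Matrix.transpose_mul, Matrix.transpose_mul,
        Matrix.transpose_transpose, hDt]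
      calc r p.castSucc.succ * D * (r p.castSucc.castSucc)ᵀ *
            (r p.castSucc.castSucc * (D * (r p.castSucc.succ)ᵀ))
          = r p.castSucc.succ * D * ((r p.castSucc.castSucc)ᵀ * r p.castSucc.castSucc) *
            (D * (r p.castSucc.succ)ᵀ) := by simp only [mul_assoc]
        _ = _ := by rw [h3, mul_one]; simp only [mul_assoc]
  have horth : ∀ q, r q ∈ Matrix.orthogonalGroup (Fin d) ℝ := by
    intro q
    cases q using Fin.cases with
    | zero => exact V.2
    | succ p => exact (hstep p (hall p).1 (hall p).2).1
  exact ⟨fun q => ⟨r q, horth q⟩, rfl,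
    ext_layer fun p => (hstep p (hall p).1 (hall p).2).2⟩

/-- Reduces the volume over `X` to the diagonal case, since the action is isometric. -/
theorem balancedFiber_eq {M : ℕ} {X : Matrix (Fin d) (Fin d) ℝ} {U V : Orth d} {s lam : Fin d → ℝ}
    (hX : X = U.1 * Matrix.diagonal s * V.1ᵀ) (hpos : ∀ i, 0 < lam i)
    (hs : ∀ i, lam i ^ (M + 1) = s i) :
    balancedFiber (M + 1) X = act (pad V U 1) '' Set.range (orbitMap (M := M) lam) := by
  have hDpow : Matrix.diagonal lam ^ (M + 1) = Matrix.diagonal s := by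
    rw [Matrix.diagonal_pow]
    congr 1
    funext i
    exact hs i
  have hlast : Fin.last (M + 1) = (Fin.last M).succ := rfl
  have hact : ∀ Q : Fin M → Orth d, act (pad V U 1) (orbitMap lam Q) =
      act (pad V U Q) (diagPoint (M + 1) lam) := by
    intro Q
    rw [orbitMap, ← act_mul, pad_mul, mul_one, mul_one, one_mul]
  apply Set.Subset.antisymm
  · rintro W ⟨hWX, hWb, -⟩
    change endToEnd W = X at hWX
    have hprod : Xᵀ * X = ((layer W 0)ᵀ * layer W 0) ^ (M + 1) := by
      rw [← hWX]
      exact transpose_prodRev_mul_self (layer W) hWb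
    have hXX : Xᵀ * X = V.1 * (Matrix.diagonal s * Matrix.diagonal s) * V.1ᵀ := by
      rw [hX, Matrix.transpose_mul, Matrix.transpose_mul, Matrix.transpose_transpose,
        Matrix.diagonal_transpose]
      simp only [mul_assoc]
      rw [← mul_assoc U.1ᵀ, U.transpose_mul_self, one_mul]
    have hconj : ∀ (A : Matrix (Fin d) (Fin d) ℝ) k, (V.1ᵀ * A * V.1) ^ k = V.1ᵀ * A ^ k * V.1 := by
      intro A k
      induction k with
      | zero => rw [pow_zero, pow_zero, mul_one, V.transpose_mul_self]
      | succ k ih =>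
        rw [pow_succ, ih, pow_succ]
        simp only [mul_assoc]
        rw [← mul_assoc V.1 V.1ᵀ, V.mul_transpose_self, one_mul]
    -- The left side is positive semidefinite and its `N`-th power is `Vᵀ Xᵀ X V = Σ²`, so it is the
    -- unique root `Λ²`.
    have hroot : V.1ᵀ * ((layer W 0)ᵀ * layer W 0) * V.1 = Matrix.diagonal fun i => lam i ^ 2 := by
      refine eq_diagonal_of_pow_eq ?_ (fun i => sq_nonneg _) M.succ_ne_zero ?_
      · have h := Matrix.posSemidef_conjTranspose_mul_self (layer W 0 * V.1)
        rw [Matrix.conjTranspose_eq_transpose_of_trivial, Matrix.transpose_mul] at h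
        simpa only [mul_assoc] using h
      · rw [hconj, Nat.succ_eq_add_one, ← hprod, hXX]
        simp only [mul_assoc]
        rw [V.transpose_mul_self, mul_one, ← mul_assoc, V.transpose_mul_self, one_mul,
          Matrix.diagonal_mul_diagonal, Matrix.diagonal_pow]
        congr 1
        funext i
        rw [Pi.pow_apply, ← hs i]
        ring
    have hV : (layer W 0)ᵀ * layer W 0 =
        V.1 * (Matrix.diagonal lam * Matrix.diagonal lam) * V.1ᵀ := by
      rw [Matrix.diagonal_mul_diagonal]
      simp only [← pow_two]
      rw [← hroot]
      simp only [mul_assoc]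
      rw [V.mul_transpose_self, mul_one, ← mul_assoc V.1, V.mul_transpose_self, one_mul]
    obtain ⟨R, hR0, rfl⟩ := exists_eq_act_diagPoint hpos hWb V hV
    -- The end-to-end product is `R_N Σ Vᵀ`. Cancelling the invertible `Σ Vᵀ` against `X = U Σ Vᵀ`
    -- fixes the right end.
    have hRU : R (Fin.last (M + 1)) = U := by
      have h1 : (R (Fin.last (M + 1))).1 * Matrix.diagonal s * V.1ᵀ =
          U.1 * Matrix.diagonal s * V.1ᵀ := by
        rw [← hX, ← hWX, endToEnd_act_diagPoint, hDpow, hR0]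
      have h2 := congrArg (fun A => A * V.1 * (Matrix.diagonal s)⁻¹) h1
      simp only [mul_assoc] at h2
      have hsu : IsUnit (Matrix.diagonal s).det :=
        isUnit_det_diagonal fun i => by rw [← hs i]; exact pow_pos (hpos i) _
      rw [← mul_assoc V.1ᵀ, V.transpose_mul_self, one_mul, Matrix.mul_nonsing_inv _ hsu, mul_one,
        mul_one] at h2
      exact Subtype.ext h2
    refine ⟨_, ⟨fun p => R p.castSucc.succ, rfl⟩, ?_⟩
    rw [hact]
    congr 1
    funext q
    cases q using Fin.cases with
    | zero => exact hR0.symm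
    | succ q =>
      cases q using Fin.lastCases with
      | last => rw [pad_last, ← hlast, hRU]
      | cast p => rw [pad_castSucc_succ]
  · rintro _ ⟨_, ⟨Q, rfl⟩, rfl⟩
    rw [hact]
    refine ⟨?_, act_diagPoint_mem_balancedManifold _ hpos⟩
    change endToEnd _ = X
    rw [endToEnd_act_diagPoint, hDpow, pad_zero, hlast, pad_last, hX]

end BalancedFiber

/-! ### Vandermonde quotients -/

section Entropy

variable {d : ℕ}

theorem van_eq_prod (α : Fin d → ℝ) : van α = ∏ i, ∏ j ∈ Finset.Ioi i, (α j - α i) := by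
  rw [← Matrix.det_vandermonde, van, ← Matrix.det_transpose]
  rfl

/-- For decreasing arguments every Vandermonde factor is negative; the signs cancel pairwise in the
quotient, leaving positive factors. -/
theorem log_van_div_van {α β : Fin d → ℝ} (hα : StrictAnti α) (hβ : StrictAnti β) :
    Real.log (van α / van β) =
      ∑ i, ∑ j ∈ Finset.Ioi i, Real.log ((α i - α j) / (β i - β j)) := by
  have h : ∀ i, ∀ j ∈ Finset.Ioi i, (α j - α i) / (β j - β i) = (α i - α j) / (β i - β j) ∧
      (α i - α j) / (β i - β j) ≠ 0 := by
    intro i j hj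
    have hij := Finset.mem_Ioi.1 hj
    refine ⟨?_, (div_pos (sub_pos.2 (hα hij)) (sub_pos.2 (hβ hij))).ne'⟩
    rw [← neg_sub (α i), ← neg_sub (β i), neg_div_neg_eq]
  rw [van_eq_prod, van_eq_prod, ← Finset.prod_div_distrib]
  simp only [← Finset.prod_div_distrib]
  rw [Real.log_prod fun i _ => Finset.prod_ne_zero_iff.2 fun j hj => by
    rw [(h i j hj).1]; exact (h i j hj).2]
  refine Finset.sum_congr rfl fun i _ => ?_
  rw [Real.log_prod fun j hj => by rw [(h i j hj).1]; exact (h i j hj).2]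
  exact Finset.sum_congr rfl fun j hj => by rw [(h i j hj).1]

end Entropy
end DLN

/-! ### Assembly of the entropy formula -/

open DLN in
theorem theorem3p1 (N d : ℕ) (hN : 1 ≤ N) (hd : 1 ≤ d) (X : Matrix (Fin d) (Fin d) ℝ)
    (hrank : X.rank = d) (hdistinct : Function.Injective (DLN.sv X)) :
    (0 < DLN.volO d ∧ DLN.volO d < ⊤) ∧
    (0 < DLN.fiberVolume N X ∧ DLN.fiberVolume N X < ⊤) ∧
    DLN.entropy N X = ((N : ℝ) - 1) * Real.log (DLN.cO d) +
      1 / 2 * Real.log (DLN.van (fun i => DLN.sv X i ^ 2) /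
        DLN.van (fun i => DLN.sv X i ^ (2 / (N : ℝ)))) ∧
    DLN.entropy N X = ((N : ℝ) - 1) * Real.log (DLN.cO d) +
      1 / 2 * ∑ i : Fin d, ∑ j ∈ Finset.Ioi i,
        Real.log ((DLN.sv X i ^ 2 - DLN.sv X j ^ 2) /
          (DLN.sv X i ^ (2 / (N : ℝ)) - DLN.sv X j ^ (2 / (N : ℝ)))) := by
  obtain ⟨M, rfl⟩ : ∃ M, N = M + 1 := ⟨N - 1, by omega⟩
  have hspos := sv_pos hrank
  have hanti := sv_strictAnti hdistinct
  obtain ⟨U, V, hX⟩ := exists_svd hrank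
  -- The common singular values of all layers, `Λ = Σ^{1/N}`.
  set lam : Fin d → ℝ := fun i => sv X i ^ (1 / ((M + 1 : ℕ) : ℝ)) with hlam
  have hN0 : (0 : ℝ) < ((M + 1 : ℕ) : ℝ) := by positivity
  have hlpos : ∀ i, 0 < lam i := fun i => Real.rpow_pos_of_pos (hspos i) _
  have hlanti : StrictAnti lam := fun i j hij =>
    Real.rpow_lt_rpow (hspos j).le (hanti hij) (by positivity)
  have hlpow : ∀ i, lam i ^ (M + 1) = sv X i := fun i => by
    rw [hlam, one_div]
    exact Real.rpow_inv_natCast_pow (hspos i).le M.succ_ne_zero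
  have hlsq : ∀ i, sv X i ^ (2 / ((M + 1 : ℕ) : ℝ)) = lam i ^ 2 := fun i => by
    rw [hlam, ← Real.rpow_natCast, ← Real.rpow_mul (hspos i).le]
    congr 1
    push_cast
    ring
  obtain ⟨hv0, hvt, hvol⟩ := volume_range_orbitMap M hlpos hlanti
  set P := ∏ k : UpperPair d, (tridiag M (lam k.1.1) (lam k.1.2)).det with hP
  have hdet0 : ∀ k : UpperPair d, 0 < (tridiag M (lam k.1.1) (lam k.1.2)).det := fun k =>
    det_tridiag_pos M (hlanti k.2) (hlpos _)
  have hP0 : 0 < P := Finset.prod_pos fun k _ => hdet0 k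
  have hfib : fiberVolume (M + 1) X = ENNReal.ofReal √P * volO d ^ M := by
    rw [fiberVolume, balancedFiber_eq hX hlpos hlpow,
      (isometry_act _).euclideanHausdorffMeasure_image, hvol]
  have hc0 : 0 < cO d := ENNReal.toReal_pos hv0.ne' hvt.ne
  have hlogP : Real.log P = ∑ i : Fin d, ∑ j ∈ Finset.Ioi i,
      Real.log ((sv X i ^ 2 - sv X j ^ 2) /
        (sv X i ^ (2 / ((M + 1 : ℕ) : ℝ)) - sv X j ^ (2 / ((M + 1 : ℕ) : ℝ)))) := by
    rw [hP, Real.log_prod fun k _ => (hdet0 k).ne', ← sum_upperPair]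
    refine Finset.sum_congr rfl fun k _ => ?_
    -- With `M + 1 = N`, the numerator `(λ²)^N` is `σ²` and the denominator `λ²` is `σ^{2/N}`.
    rw [det_tridiag_eq_div M (hlanti k.2) (hlpos _), hlsq, hlsq, ← hlpow, ← hlpow]
    congr 2
    ring
  have hS : entropy (M + 1) X = (((M + 1 : ℕ) : ℝ) - 1) * Real.log (cO d) + 1 / 2 * Real.log P := by
    rw [entropy, hfib, ENNReal.toReal_mul, ENNReal.toReal_pow,
      ENNReal.toReal_ofReal (Real.sqrt_nonneg _), ← cO,
      Real.log_mul (Real.sqrt_pos.2 hP0).ne' (pow_ne_zero _ hc0.ne'), Real.log_sqrt hP0.le,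
      Real.log_pow]
    push_cast
    ring
  refine ⟨⟨hv0, hvt⟩, ?_, ?_, ?_⟩
  · rw [hfib]
    exact ⟨ENNReal.mul_pos (by simpa using hP0) (pow_ne_zero _ hv0.ne'),
      ENNReal.mul_lt_top ENNReal.ofReal_lt_top (ENNReal.pow_lt_top hvt)⟩
  · rw [hS, hlogP, log_van_div_van (fun i j hij => pow_lt_pow_left₀ (hanti hij) (hspos j).le
      two_ne_zero) fun i j hij => Real.rpow_lt_rpow (hspos j).le (hanti hij) (by positivity)]
  · rw [hS, hlogP]
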